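/- Let $(R,\mathfrak m)$ be a regular local ring of prime characteristic $p>0$, and let $f\in\mathfrak m$. For $e\ge 0$ let $$\mu_f(p^e)=\min\{k\in\mathbb N : f^k\in\mathfrak m^{[p^e]}\},$$ where $\mathfrak m^{[p^e]}$ is the ideal generated by the elements $r^{p^e}$ with $r\in\mathfrak m$, and let $$\mathrm{fpt}(f)=\lim_{e\to\infty}\frac{\mu_f(p^e)}{p^e}$$ be the $F$-pure threshold of $f$ (the limit exists, the sequence being non-increasing and bounded below by $0$). Then the generating function $$G_f(z)=\sum_{e\ge 0}\mu_f(p^e)\,z^e$$ is a rational function of $z$: there is $G\in\mathbb Q(z)$ whose power series expansion at $0$ is $G_f(z)$, and the series $G_f(z)$ converges to $G(z)$ for all $z\in\mathbb C$ with $|z|<1/p$. If $f\neq 0$, then $G$ has a simple pole at $z=1/p$. Moreover $$\mathrm{fpt}(f)=\lim_{z\to 1/p}(1-pz)\,G(z).$$ -/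

import Mathlib

open IsLocalRing Filter Topology

namespace FPureThreshold

variable {R : Type*} [CommRing R]

/-- The bracket power `I^[q]`: the ideal generated by the elements `r ^ q` with `r ∈ I`. -/
def bracketPower (I : Ideal R) (q : ℕ) : Ideal R :=
  Ideal.span ((fun r : R => r ^ q) '' (I : Set R))

/-- `μ_f(q)`, the least natural number `k` with `f ^ k ∈ 𝔪^[q]`. -/
noncomputable def mu [IsLocalRing R] (f : R) (q : ℕ) : ℕ :=
  sInf {k : ℕ | f ^ k ∈ bracketPower (maximalIdeal R) q}

/-- The `F`-pure threshold of `f`: the limit of `μ_f(p^e) / p^e` as `e → ∞`.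
The limit exists for every `f ∈ 𝔪`, see `tendsto_fpt`. -/
noncomputable def fpt [IsLocalRing R] (p : ℕ) (f : R) : ℝ :=
  limUnder atTop (fun e : ℕ => (mu f (p ^ e) : ℝ) / (p : ℝ) ^ e)

/-- The generating function `∑ μ_f(p^e) z^e`, as a formal power series. -/
noncomputable def genFun [IsLocalRing R] (p : ℕ) (f : R) : PowerSeries ℚ :=
  PowerSeries.mk fun e : ℕ => (mu f (p ^ e) : ℚ)

/-- The function of a complex variable defined by a rational function with rational
coefficients (numerator over denominator, in lowest terms). -/
noncomputable def toFun (G : RatFunc ℚ) (z : ℂ) : ℂ :=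
  RatFunc.eval (algebraMap ℚ ℂ) z G

theorem pow_mem_bracketPower (p : ℕ) [Fact p.Prime] [CharP R p] {I : Ideal R} {q : ℕ} {x : R}
    (hx : x ∈ bracketPower I q) : x ^ p ∈ bracketPower I (p * q) := by
  have h : (bracketPower I q).map (frobenius R p) ≤ bracketPower I (p * q) := by
    rw [bracketPower, Ideal.map_span, Ideal.span_le]
    rintro _ ⟨_, ⟨r, hr, rfl⟩, rfl⟩
    refine Ideal.subset_span ⟨r, hr, ?_⟩
    simp [frobenius_def, ← pow_mul, mul_comm]
  exact h (Ideal.mem_map_of_mem (frobenius R p) hx)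

section Basic

variable [IsLocalRing R]

/-- For `f ∈ 𝔪` the minimum defining `μ_f(q)` is attained. -/
theorem pow_mu_mem {f : R} (hf : f ∈ maximalIdeal R) (q : ℕ) :
    f ^ mu f q ∈ bracketPower (maximalIdeal R) q :=
  Nat.sInf_mem (s := {k : ℕ | f ^ k ∈ bracketPower (maximalIdeal R) q})
    ⟨q, Ideal.subset_span ⟨f, hf, rfl⟩⟩

theorem mu_mul_le (p : ℕ) [Fact p.Prime] [CharP R p] {f : R} (hf : f ∈ maximalIdeal R) (q : ℕ) :
    mu f (p * q) ≤ p * mu f q := by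
  refine Nat.sInf_le ?_
  have h := pow_mem_bracketPower p (pow_mu_mem hf q)
  rwa [← pow_mul, mul_comm (mu f q) p] at h

/-- The limit defining the `F`-pure threshold exists. -/
theorem tendsto_fpt (p : ℕ) [Fact p.Prime] [CharP R p] {f : R} (hf : f ∈ maximalIdeal R) :
    Tendsto (fun e : ℕ => (mu f (p ^ e) : ℝ) / (p : ℝ) ^ e) atTop (𝓝 (fpt p f)) := by
  have hp : (0 : ℝ) < p := by exact_mod_cast (Fact.out : p.Prime).pos
  have hanti : Antitone (fun e : ℕ => (mu f (p ^ e) : ℝ) / (p : ℝ) ^ e) := by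
    refine antitone_nat_of_succ_le fun e => ?_
    have h : (mu f (p * p ^ e) : ℝ) ≤ p * mu f (p ^ e) := by exact_mod_cast mu_mul_le p hf (p ^ e)
    rw [div_le_div_iff₀ (by positivity) (by positivity), pow_succ' p e, pow_succ' (p : ℝ) e]
    calc (mu f (p * p ^ e) : ℝ) * (p : ℝ) ^ e ≤ (p * mu f (p ^ e)) * (p : ℝ) ^ e := by gcongr
      _ = _ := by ring
  have hbdd : BddBelow (Set.range fun e : ℕ => (mu f (p ^ e) : ℝ) / (p : ℝ) ^ e) :=
    ⟨0, by rintro _ ⟨e, rfl⟩; positivity⟩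
  exact tendsto_nhds_limUnder ⟨_, tendsto_atTop_ciInf hanti hbdd⟩

end Basic

end FPureThreshold

/-!
Let `d = (d₀, d₁, …)` be the base-`p` digits such that `μ_f(p ^ e) - 1` is the integer with digits
`d₀, …, d_{e-1}`. All assertions reduce to one fact: **`d` is eventually periodic**. Granting it,
`μ_f(p ^ (e + 1)) - p μ_f(p ^ e) = d_e + 1 - p` is bounded and eventually periodic, so
`(1 - z ^ b) (1 - p z) G_f(z)` is a polynomial for a period `b`. The series of `(1 - p z) G_f(z)`
converges for `|z| < 1`, and at `z = 1 / p` its partial sums telescope to `μ_f(p ^ e) / p ^ e`,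
whose limit is `fpt f`. If `f ≠ 0`, then `fpt f ≠ 0` by Krull's intersection theorem, hence the
simple pole (`exists_ratFunc_of_periodic`, `FPureThreshold.fpt_ne_zero`).

Periodicity is read off from the top local cohomology `E = Hⁿ_𝔪(R)` with its Frobenius action `F`.
If `x₁, …, xₙ` are minimal generators of `𝔪`, the class `y t` of `1 / (x₁ ⋯ xₙ) ^ t` has annihilator
`(x₁ᵗ, …, xₙᵗ)` and `F (y t) = y (p t)`; thus `f ^ k ∈ 𝔪^[p ^ e]` means `f ^ k • Fᵉ (y 1) = 0`.
The digits arise greedily from `η₀ = y 1` and `η_{e+1} = f ^ d_e • F η_e`, where `d_e` is the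
largest exponent giving a nonzero result (`exists_greedy_word`). Each `η_e` is killed by `f`.

To a digit sequence `w` belongs the submodule `K_w` of the elements of `E` killed by
`f ^ w_{e-1} F ∘ ⋯ ∘ f ^ w₀ F` for some `e`. It grows with `w` in the lexicographic order, and
`η_j` lies in `K_w` whenever the `j`-th shift of `d` is smaller than `w`, but not if `w` is this
shift. As `E` is Artinian, the shifts of `d` contain no infinite lexicographically descending chain.
A compactness argument on the closure of the shifts shows that then either `d` is eventually
periodic, or the shifts of `d` approach a periodic sequence `w` from below
(`eventually_periodic_or_exists_periodic_limit`). In the second case let `θ` be the composite of the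
maps `f ^ w_i F` over one period of `w`: the elements `η_j` are nilpotent under `θ`, of unbounded
order. This contradicts the Hartshorne–Speiser–Lyubeznik theorem
(`exists_iterate_eq_zero_of_semilinear`, `greedy_word_eventually_periodic`).

The Hartshorne–Speiser–Lyubeznik theorem needs Matlis duality, which usually requires passing to the
completion of `R`. Its role is taken here by the ring `S` of `R`-linear endomorphisms of `E`: the
module `E` is injective (`IsInverseSystem.baer`), which makes `S` a commutative Noetherian ring for
which submodules of `E` are separated by their annihilators, and `F` is semilinear over `S` as well.
-/

universe u

/-! ### Regular local rings and regular sequences -/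

/-- In a local ring `R` with `𝔪 = (s)`, an element of `𝔪` outside `𝔪²` can replace one of the
generators. -/
theorem IsLocalRing.exists_span_insert_erase_eq {R : Type u} [CommRing R] [IsLocalRing R]
    [DecidableEq R] {s : Finset R} (hs : Ideal.span (s : Set R) = maximalIdeal R) {x : R}
    (hx : x ∈ maximalIdeal R) (hx2 : x ∉ maximalIdeal R ^ 2) :
    ∃ y ∈ s, Ideal.span (insert x (s.erase y : Finset R) : Set R) = maximalIdeal R := by
  have hx' := hx
  rw [← hs] at hx'
  obtain ⟨c, hc⟩ := Submodule.mem_span_finset'.1 hx'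
  have hex : ∃ y : s, c y ∉ maximalIdeal R := by
    by_contra! h
    refine hx2 ?_
    rw [← hc, pow_two]
    refine Ideal.sum_mem _ fun i _ => Ideal.mul_mem_mul (h i) ?_
    rw [← hs]
    exact Ideal.subset_span i.2
  obtain ⟨y, hy⟩ := hex
  refine ⟨y, y.2, le_antisymm ?_ ?_⟩
  · rw [Ideal.span_le, Set.insert_subset_iff]
    refine ⟨hx, fun z hz => ?_⟩
    rw [SetLike.mem_coe, ← hs]
    exact Ideal.subset_span (Finset.mem_of_mem_erase hz)
  · set J := Ideal.span (insert x (s.erase y : Finset R) : Set R) with hJ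
    have hz : ∀ z ∈ s, z ≠ y → z ∈ J := fun z hz hzy =>
      Ideal.subset_span (Or.inr (Finset.mem_coe.2 (Finset.mem_erase.2 ⟨hzy, hz⟩)))
    have hu : IsUnit (c y) := by simpa using hy
    have hyJ : (y : R) ∈ J := by
      rw [← Finset.add_sum_erase _ _ (Finset.mem_univ y)] at hc
      have h1 : c y * (y : R) ∈ J := by
        have : c y * (y : R) = x - ∑ i ∈ Finset.univ.erase y, c i • (i : R) := by
          rw [← hc, smul_eq_mul]; ring
        rw [this]
        refine J.sub_mem (Ideal.subset_span (Set.mem_insert _ _)) (J.sum_mem fun i hi => ?_)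
        exact J.mul_mem_left _ (hz i i.2 fun h => (Finset.mem_erase.1 hi).1 (Subtype.ext h))
      exact (J.unit_mul_mem_iff_mem hu).1 h1
    rw [← hs, Ideal.span_le]
    intro z hzs
    by_cases h : z = y
    · rw [h]; exact hyJ
    · exact hz z hzs h

/-- If `𝔪` is generated by `T ∪ s'` and `|T| + |s'| ≤ dim R`, then the maximal ideal of the local
ring `R / (T)` is generated by at most `dim R / (T)` elements, namely the images of `s'`. -/
theorem IsLocalRing.card_image_le_ringKrullDim_quotient {R : Type u} [CommRing R] [IsLocalRing R]
    [IsNoetherianRing R] [DecidableEq R] {T s' : Finset R}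
    (hs : Ideal.span ((T : Set R) ∪ s') = maximalIdeal R)
    (hd : ((T.card + s'.card : ℕ) : WithBot ℕ∞) ≤ ringKrullDim R) :
    ∃ (_ : IsLocalRing (R ⧸ Ideal.span (T : Set R)))
      (s'' : Finset (R ⧸ Ideal.span (T : Set R))),
      s''.card ≤ s'.card ∧ Ideal.span (s'' : Set _) = maximalIdeal (R ⧸ Ideal.span (T : Set R)) ∧
      (s''.card : WithBot ℕ∞) ≤ ringKrullDim (R ⧸ Ideal.span (T : Set R)) := by
  classical
  have hT : (T : Set R) ⊆ maximalIdeal R := by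
    rw [← hs]
    exact fun a ha => Ideal.subset_span (Or.inl ha)
  have htop : Ideal.span (T : Set R) ≠ ⊤ := fun h =>
    (IsLocalRing.maximalIdeal.isMaximal R).ne_top (top_le_iff.1 (h ▸ Ideal.span_le.2 hT))
  have : Nontrivial (R ⧸ Ideal.span (T : Set R)) := Ideal.Quotient.nontrivial_iff.2 htop
  have hloc : IsLocalRing (R ⧸ Ideal.span (T : Set R)) :=
    IsLocalRing.of_surjective' (Ideal.Quotient.mk _) Ideal.Quotient.mk_surjective
  refine ⟨hloc, s'.image (Ideal.Quotient.mk _), Finset.card_image_le, ?_, ?_⟩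
  · rw [← IsLocalRing.map_maximalIdeal_of_surjective _
      (Ideal.Quotient.mk_surjective (I := Ideal.span (T : Set R))), ← hs, Ideal.map_span,
      Set.image_union, Ideal.span_union, Finset.coe_image, ← Ideal.map_span _ (T : Set R),
      Ideal.map_quotient_self, bot_sup_eq]
  · refine le_trans (b := (s'.card : WithBot ℕ∞)) (by exact_mod_cast Finset.card_image_le) ?_
    have h1 := hd.trans (ringKrullDim_le_ringKrullDim_quotient_add_card T
      (by rwa [IsLocalRing.ringJacobson_eq_maximalIdeal]))
    have h0 : 0 ≤ ringKrullDim (R ⧸ Ideal.span (T : Set R)) := ringKrullDim_nonneg_of_nontrivial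
    generalize ringKrullDim (R ⧸ Ideal.span (T : Set R)) = d at *
    induction d with
    | bot => exact absurd h0 (by decide)
    | coe d =>
      induction d using ENat.recTopCoe with
      | top => exact le_top
      | coe d =>
        have h2 : T.card + s'.card ≤ d + T.card := by exact_mod_cast h1
        exact_mod_cast (by omega : s'.card ≤ d)

/-- A Noetherian local ring whose maximal ideal is generated by at most `dim R` elements is a
domain. -/
theorem isDomain_of_maximalIdeal_eq_span {R : Type u} [CommRing R] [IsLocalRing R]
    [IsNoetherianRing R] (s : Finset R) (hs : Ideal.span (s : Set R) = maximalIdeal R)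
    (hd : (s.card : WithBot ℕ∞) ≤ ringKrullDim R) : IsDomain R := by
  classical
  induction hn : s.card using Nat.strong_induction_on generalizing R with | _ n ih => ?_
  cases n with
  | zero =>
    have : s = ∅ := Finset.card_eq_zero.1 hn
    rw [this, Finset.coe_empty, Ideal.span_empty] at hs
    exact (IsLocalRing.isField_iff_maximalIdeal_eq.2 hs.symm).isDomain
  | succ k =>
    have hpos : (1 : WithBot ℕ∞) ≤ ringKrullDim R := by
      refine le_trans ?_ hd
      rw [hn]
      exact_mod_cast Nat.le_add_left 1 k
    have hmin : ∀ P ∈ minimalPrimes R, ¬ maximalIdeal R ≤ P := by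
      intro P hP hle
      have h0 : (maximalIdeal R).height = 0 := by
        have : P = maximalIdeal R :=
          le_antisymm (IsLocalRing.le_maximalIdeal hP.isPrime.ne_top) hle
        rw [← this]
        have := hP.isPrime
        exact Ideal.height_eq_zero_iff.2 hP
      have := IsLocalRing.maximalIdeal_height_eq_ringKrullDim (R := R)
      rw [h0] at this
      rw [← this] at hpos
      exact absurd hpos (by decide)
    have hsq : ¬ maximalIdeal R ≤ maximalIdeal R ^ 2 := by
      intro hle
      have hb : maximalIdeal R = ⊥ := by
        refine Submodule.eq_bot_of_le_smul_of_le_jacobson_bot (maximalIdeal R) _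
          (IsNoetherian.noetherian _) ?_ (by rw [IsLocalRing.jacobson_eq_maximalIdeal _ bot_ne_top])
        rw [smul_eq_mul, ← pow_two]
        exact hle
      obtain ⟨P, hP⟩ := Ideal.nonempty_minimalPrimes (bot_ne_top : (⊥ : Ideal R) ≠ ⊤)
      exact hmin P hP (by rw [hb]; exact bot_le)
    -- prime avoidance
    obtain ⟨x, hx, hx2, hxmin⟩ : ∃ x ∈ maximalIdeal R, x ∉ maximalIdeal R ^ 2 ∧
        ∀ P ∈ minimalPrimes R, x ∉ P := by
      by_contra! hcon
      have hfin := minimalPrimes.finite_of_isNoetherianRing R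
      have := (Ideal.subset_union_prime (s := insert (maximalIdeal R ^ 2) hfin.toFinset)
        (f := id) (maximalIdeal R ^ 2) (maximalIdeal R ^ 2) (I := maximalIdeal R) (by
          intro i hi h1 _
          have := (Finset.mem_insert.1 hi).resolve_left h1
          exact (hfin.mem_toFinset.1 this).isPrime)).1 (by
          intro y hy
          simp only [Set.mem_iUnion]
          by_cases h2 : y ∈ maximalIdeal R ^ 2
          · exact ⟨_, Finset.mem_insert_self _ _, h2⟩
          · obtain ⟨P, hP, hyP⟩ := hcon y hy h2
            exact ⟨P, Finset.mem_insert_of_mem (hfin.mem_toFinset.2 hP), hyP⟩)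
      obtain ⟨I, hI, hle⟩ := this
      rcases Finset.mem_insert.1 hI with rfl | hI
      · exact hsq hle
      · exact hmin I (hfin.mem_toFinset.1 hI) hle
    obtain ⟨y, hy, hspan⟩ := IsLocalRing.exists_span_insert_erase_eq hs hx hx2
    have hdom : IsDomain (R ⧸ Ideal.span {x}) := by
      have hc : (s.erase y).card = k := by rw [Finset.card_erase_of_mem hy, hn]; rfl
      obtain ⟨hloc, s'', hle, hsp, hdim⟩ := IsLocalRing.card_image_le_ringKrullDim_quotient
        (T := {x}) (s' := s.erase y) (by rwa [Finset.coe_singleton, Set.singleton_union])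
        (by rwa [Finset.card_singleton, hc, add_comm, ← hn])
      rw [← Finset.coe_singleton]
      exact ih _ (by omega) s'' hsp hdim rfl
    have hprime : (Ideal.span {x}).IsPrime := (Ideal.Quotient.isDomain_iff_prime _).1 hdom
    obtain ⟨q, hq, hqx⟩ := Ideal.exists_minimalPrimes_le (bot_le : (⊥ : Ideal R) ≤ Ideal.span {x})
    have hqp := hq.isPrime
    have hqbot : q = ⊥ := by
      refine Submodule.eq_bot_of_le_smul_of_le_jacobson_bot (maximalIdeal R) _
          (IsNoetherian.noetherian _) ?_ (by rw [IsLocalRing.jacobson_eq_maximalIdeal _ bot_ne_top])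
      intro a ha
      obtain ⟨b, rfl⟩ := Ideal.mem_span_singleton'.1 (hqx ha)
      rw [mul_comm]
      exact Submodule.smul_mem_smul hx ((hqp.mem_or_mem ha).resolve_right (hxmin q hq))
    rw [hqbot] at hqp
    have : IsDomain (R ⧸ (⊥ : Ideal R)) := (Ideal.Quotient.isDomain_iff_prime _).2 hqp
    exact (RingEquiv.quotientBot R).symm.isDomain

/-- In a Noetherian local ring whose maximal ideal is generated by a set `s` of at most `dim R`
elements, `s` is a regular sequence in any order. -/
theorem mem_span_of_mul_mem_span {R : Type u} [CommRing R] [IsLocalRing R]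
    [IsNoetherianRing R] (s : Finset R) (hs : Ideal.span (s : Set R) = maximalIdeal R)
    (hd : (s.card : WithBot ℕ∞) ≤ ringKrullDim R) {T : Finset R} (hT : T ⊆ s) {x : R} (hx : x ∈ s)
    (hxT : x ∉ T) {r : R} (h : x * r ∈ Ideal.span (T : Set R)) : r ∈ Ideal.span (T : Set R) := by
  classical
  obtain ⟨hloc, s'', hle, hsp, hdim⟩ := IsLocalRing.card_image_le_ringKrullDim_quotient
    (T := T) (s' := s \ T) (by rwa [← Finset.coe_union, Finset.union_sdiff_of_subset hT])
    (by rwa [add_comm, Finset.card_sdiff_add_card_eq_card hT])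
  have hdom := isDomain_of_maximalIdeal_eq_span s'' hsp hdim
  have hprime : (Ideal.span (T : Set R)).IsPrime := (Ideal.Quotient.isDomain_iff_prime _).1 hdom
  refine (hprime.mem_or_mem h).resolve_left fun hxI => ?_
  have he : Ideal.span ((s.erase x : Finset R) : Set R) = maximalIdeal R := by
    rw [← hs]
    refine le_antisymm (Ideal.span_mono (by simp)) (Ideal.span_le.2 fun z hz => ?_)
    by_cases hzx : z = x
    · rw [hzx]
      refine Ideal.span_mono (fun t ht => ?_) hxI
      exact Finset.mem_coe.2 (Finset.mem_erase.2 ⟨fun h => hxT (h ▸ ht), hT ht⟩)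
    · exact Ideal.subset_span (Finset.mem_coe.2 (Finset.mem_erase.2 ⟨hzx, hz⟩))
  have h1 := hd.trans (ringKrullDim_le_spanFinrank_maximalIdeal R)
  have h2 : (maximalIdeal R).spanFinrank ≤ (s.erase x).card := by
    rw [← he, ← Set.ncard_coe_finset]
    exact Submodule.spanFinrank_span_le_ncard_of_finite (Finset.finite_toSet _)
  have h3 : s.card ≤ (maximalIdeal R).spanFinrank := by exact_mod_cast h1
  rw [Finset.card_erase_of_mem hx] at h2
  have := Finset.card_pos.2 ⟨x, hx⟩
  omega

/-! ### Ideals generated by powers of a regular sequence -/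

section MonomialIdeals

variable {R : Type*} [CommRing R] {ι : Type*}

/-- The ideal generated by the powers `x i ^ a i` with `i ∈ T`. -/
def powIdeal (x : ι → R) (T : Finset ι) (a : ι → ℕ) : Ideal R :=
  Ideal.span ((fun i => x i ^ a i) '' (T : Set ι))

/-- The family `x` is a regular sequence in any order: `x j` is a nonzerodivisor modulo each ideal
generated by other members of the family. -/
def IsPermRegular (x : ι → R) : Prop :=
  ∀ (T : Finset ι) (j : ι), j ∉ T → ∀ r : R,
    x j * r ∈ Ideal.span (x '' (T : Set ι)) → r ∈ Ideal.span (x '' (T : Set ι))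

variable {x : ι → R}

theorem pow_mem_powIdeal {T : Finset ι} (a : ι → ℕ) {i : ι} (hi : i ∈ T) :
    x i ^ a i ∈ powIdeal x T a :=
  Ideal.subset_span ⟨i, hi, rfl⟩

theorem powIdeal_le {T : Finset ι} {a : ι → ℕ} {J : Ideal R}
    (h : ∀ i ∈ T, x i ^ a i ∈ J) : powIdeal x T a ≤ J := by
  rw [powIdeal, Ideal.span_le]
  rintro _ ⟨i, hi, rfl⟩
  exact h i hi

theorem powIdeal_anti {T : Finset ι} {a b : ι → ℕ} (h : ∀ i ∈ T, a i ≤ b i) :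
    powIdeal x T b ≤ powIdeal x T a :=
  powIdeal_le fun i hi => Ideal.mem_of_dvd _ (pow_dvd_pow _ (h i hi)) (pow_mem_powIdeal a hi)

theorem powIdeal_congr {T : Finset ι} {a b : ι → ℕ} (h : ∀ i ∈ T, a i = b i) :
    powIdeal x T a = powIdeal x T b :=
  le_antisymm (powIdeal_anti fun i hi => (h i hi).ge) (powIdeal_anti fun i hi => (h i hi).le)

/-- The ideal `(x₁ᵗ, …, xₙᵗ)`. -/
def unifPowIdeal [Fintype ι] (x : ι → R) (t : ℕ) : Ideal R := powIdeal x Finset.univ fun _ => t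

theorem prod_pow_mul_mem_unifPowIdeal [Fintype ι] {t : ℕ} (k : ℕ) {r : R}
    (h : r ∈ unifPowIdeal x t) :
    (∏ i, x i) ^ k * r ∈ unifPowIdeal x (t + k) := by
  have : unifPowIdeal x t ≤ (unifPowIdeal x (t + k)).colon {(∏ i, x i) ^ k} := by
    refine powIdeal_le fun i _ => ?_
    rw [Submodule.mem_colon_singleton, smul_eq_mul]
    refine Ideal.mem_of_dvd _ ?_ (pow_mem_powIdeal _ (Finset.mem_univ i))
    rw [pow_add]
    exact mul_dvd_mul_left _ (pow_dvd_pow_of_dvd (Finset.dvd_prod_of_mem _ (Finset.mem_univ i)) _)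
  have := Submodule.mem_colon_singleton.1 (this h)
  rwa [smul_eq_mul, mul_comm] at this

variable [DecidableEq ι]

theorem mem_powIdeal_iff {T : Finset ι} {i : ι} (hi : i ∈ T) {a : ι → ℕ} {r : R} :
    r ∈ powIdeal x T a ↔ ∃ c, ∃ u ∈ powIdeal x (T.erase i) a, r = x i ^ a i * c + u := by
  have : powIdeal x T a = Ideal.span {x i ^ a i} ⊔ powIdeal x (T.erase i) a := by
    rw [powIdeal, powIdeal, ← Ideal.span_union, Finset.coe_erase]
    congr 1
    conv_lhs => rw [← Set.insert_eq_of_mem (Finset.mem_coe.2 hi), ← Set.insert_sdiff_singleton,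
      Set.image_insert_eq]
    rfl
  rw [this, Submodule.mem_sup]
  constructor
  · rintro ⟨y, hy, u, hu, rfl⟩
    obtain ⟨c, rfl⟩ := Ideal.mem_span_singleton'.1 hy
    exact ⟨c, u, hu, by ring⟩
  · rintro ⟨c, u, hu, rfl⟩
    exact ⟨_, Ideal.mem_span_singleton'.2 ⟨c, by ring⟩, u, hu, rfl⟩

/-- Modulo an ideal generated by powers of other members of the family, `x j` is still a
nonzerodivisor. The proof is by induction on the sum of the exponents. -/
theorem IsPermRegular.mem_powIdeal_of_mul (hx : IsPermRegular x) (T : Finset ι) (a : ι → ℕ)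
    {j : ι} (hj : j ∉ T) {r : R} (h : x j * r ∈ powIdeal x T a) : r ∈ powIdeal x T a := by
  induction hn : ∑ i ∈ T, a i using Nat.strong_induction_on generalizing T a j r with
  | _ n ih => ?_
  by_cases h0 : ∃ i ∈ T, a i = 0
  · obtain ⟨i, hi, hai⟩ := h0
    have := pow_mem_powIdeal (x := x) a hi
    rw [hai, pow_zero] at this
    exact (Ideal.eq_top_iff_one _).2 this ▸ Submodule.mem_top
  by_cases h2 : ∃ i ∈ T, 2 ≤ a i
  · obtain ⟨i, hi, hai⟩ := h2
    obtain ⟨b, hb⟩ : ∃ b, a i = b + 1 := ⟨a i - 1, by omega⟩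
    have hji : j ≠ i := fun h => hj (h ▸ hi)
    have herase : ∀ m, powIdeal x (T.erase i) (Function.update a i m) =
        powIdeal x (T.erase i) a := fun m => powIdeal_congr fun l hl => by
      rw [Function.update_of_ne (Finset.ne_of_mem_erase hl)]
    have hsum : ∀ m, ∑ l ∈ T, Function.update a i m l + a i = n + m := fun m => by
      rw [Finset.sum_update_of_mem hi, ← hn, ← Finset.add_sum_erase T a hi,
        Finset.sdiff_singleton_eq_erase]
      ring
    have hlt : ∑ l ∈ T.erase i, a l < n := by
      have := Finset.add_sum_erase T a hi
      omega
    have hr : r ∈ powIdeal x T (Function.update a i b) := by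
      refine ih _ (by have := hsum b; omega) T _ hj (powIdeal_anti (fun l _ => ?_) h) rfl
      by_cases hl : l = i
      · subst hl; rw [Function.update_self]; omega
      · rw [Function.update_of_ne hl]
    obtain ⟨s, u, hu, rfl⟩ := (mem_powIdeal_iff hi).1 hr
    rw [Function.update_self] at h ⊢
    rw [herase] at hu
    obtain ⟨v, w, hw, hvw⟩ := (mem_powIdeal_iff hi).1 h
    rw [hb] at hvw
    have hcancel : ∀ k : ℕ, ∀ z, x i ^ k * z ∈ powIdeal x (T.erase i) a →
        z ∈ powIdeal x (T.erase i) a := by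
      intro k
      induction k with
      | zero => intro z hz; simpa using hz
      | succ k ihk =>
        intro z hz
        refine ihk z (ih _ hlt _ a (Finset.notMem_erase i T) (r := x i ^ k * z) ?_ rfl)
        rwa [← mul_assoc, ← pow_succ']
    have h3 : x j * s - x i * v ∈ powIdeal x (T.erase i) a := by
      refine hcancel b _ ?_
      have : x i ^ b * (x j * s - x i * v) = w - x j * u := by
        linear_combination hvw
      rw [this]
      exact Ideal.sub_mem _ hw (Ideal.mul_mem_left _ _ hu)
    have h4 : s ∈ powIdeal x T (Function.update a i 1) := by
      refine ih _ (by have := hsum 1; omega) T _ hj ?_ rfl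
      refine (mem_powIdeal_iff hi).2 ⟨v, x j * s - x i * v, by rwa [herase], ?_⟩
      rw [Function.update_self]; ring
    obtain ⟨c, u', hu', rfl⟩ := (mem_powIdeal_iff hi).1 h4
    rw [Function.update_self]
    rw [herase] at hu'
    refine (mem_powIdeal_iff hi).2 ⟨c, x i ^ b * u' + u,
      Ideal.add_mem _ (Ideal.mul_mem_left _ _ hu') hu, ?_⟩
    rw [hb]; ring
  · have h1 : powIdeal x T a = Ideal.span (x '' (T : Set ι)) := by
      push Not at h0 h2
      rw [powIdeal_congr (b := fun _ => 1) fun i hi => by have := h0 i hi; have := h2 i hi; omega]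
      simp [powIdeal]
    rw [h1] at h ⊢
    exact hx T j hj r h

theorem IsPermRegular.mem_powIdeal_of_pow_mul (hx : IsPermRegular x) {T : Finset ι} {a : ι → ℕ}
    {j : ι} (hj : j ∈ T) {k : ℕ} (hk : k ≤ a j) {r : R} (h : x j ^ k * r ∈ powIdeal x T a) :
    r ∈ powIdeal x T (Function.update a j (a j - k)) := by
  have hcancel : ∀ k : ℕ, ∀ z, x j ^ k * z ∈ powIdeal x (T.erase j) a →
      z ∈ powIdeal x (T.erase j) a := by
    intro k
    induction k with
    | zero => intro z hz; simpa using hz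
    | succ k ihk =>
      intro z hz
      refine ihk z (hx.mem_powIdeal_of_mul _ a (Finset.notMem_erase j T) ?_)
      rwa [← mul_assoc, ← pow_succ']
  obtain ⟨c, u, hu, hcu⟩ := (mem_powIdeal_iff hj).1 h
  refine (mem_powIdeal_iff hj).2 ⟨c, r - x j ^ (a j - k) * c, ?_, ?_⟩
  · rw [powIdeal_congr (b := a) fun i hi => by
      rw [Function.update_of_ne (Finset.ne_of_mem_erase hi)]]
    refine hcancel k _ ?_
    have h1 : x j ^ k * x j ^ (a j - k) = x j ^ a j := by rw [← pow_add]; congr 1; omega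
    have : x j ^ k * (r - x j ^ (a j - k) * c) = u := by
      linear_combination hcu - c * h1
    rwa [this]
  · rw [Function.update_self]; ring

theorem IsPermRegular.mem_powIdeal_of_prod_mul (hx : IsPermRegular x) {T : Finset ι}
    {a : ι → ℕ} (k : ι → ℕ) {U : Finset ι} (hU : U ⊆ T) (hk : ∀ i ∈ U, k i ≤ a i) {r : R}
    (h : (∏ i ∈ U, x i ^ k i) * r ∈ powIdeal x T a) :
    r ∈ powIdeal x T (fun i => if i ∈ U then a i - k i else a i) := by
  induction U using Finset.induction_on generalizing r with
  | empty => simpa using h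
  | insert j U hjU ih =>
    rw [Finset.prod_insert hjU, mul_comm (x j ^ k j), mul_assoc] at h
    have h1 := ih ((Finset.subset_insert _ _).trans hU)
      (fun i hi => hk i (Finset.mem_insert_of_mem hi)) h
    have hj := hk j (Finset.mem_insert_self _ _)
    have h2 := hx.mem_powIdeal_of_pow_mul (hU (Finset.mem_insert_self _ _)) (by simpa [hjU]) h1
    rwa [powIdeal_congr (b := fun i => if i ∈ insert j U then a i - k i else a i)] at h2
    intro i _
    by_cases hij : i = j
    · subst hij; simp [hjU]
    · simp [hij]

variable [Fintype ι]

/-- The colon ideal `(x₁ˢ, …, xₙˢ) : (x₁ ⋯ xₙ) ^ k` is `(x₁ᵗ, …, xₙᵗ)` for `s = t + k`. -/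
theorem IsPermRegular.mem_unifPowIdeal_of_prod_pow_mul (hx : IsPermRegular x) {t k : ℕ} {r : R}
    (h : (∏ i, x i) ^ k * r ∈ unifPowIdeal x (t + k)) : r ∈ unifPowIdeal x t := by
  rw [← Finset.prod_pow] at h
  have := hx.mem_powIdeal_of_prod_mul (fun _ => k) subset_rfl (fun _ _ => Nat.le_add_left k t) h
  simpa [unifPowIdeal] using this

/-- The colon ideal `(x₁ˢ, …, xₙˢ) : (x₁ᵗ, …, xₙᵗ)` is generated by `x₁ˢ, …, xₙˢ` and
`(x₁ ⋯ xₙ)^(s - t)`. -/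
theorem IsPermRegular.mem_sup_of_forall_pow_mul (hx : IsPermRegular x) {s t : ℕ} (hts : t ≤ s)
    {r : R} (h : ∀ i, x i ^ t * r ∈ unifPowIdeal x s) :
    ∃ c, r - (∏ i, x i) ^ (s - t) * c ∈ unifPowIdeal x s := by
  have key : ∀ T : Finset ι, ∃ c, r - (∏ i ∈ T, x i ^ (s - t)) * c ∈ unifPowIdeal x s := by
    intro T
    induction T using Finset.induction_on with
    | empty => exact ⟨r, by simp⟩
    | insert j T hj ih =>
      obtain ⟨c, hc⟩ := ih
      set P := ∏ i ∈ T, x i ^ (s - t) with hP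
      have h1 : (x j ^ t * P) * c ∈ unifPowIdeal x s := by
        have : (x j ^ t * P) * c = x j ^ t * r - x j ^ t * (r - P * c) := by ring
        rw [this]
        exact Ideal.sub_mem _ (h j) (Ideal.mul_mem_left _ _ hc)
      have h2 : (∏ i ∈ insert j T, x i ^ (if i ∈ T then s - t else t)) = x j ^ t * P := by
        rw [Finset.prod_insert hj, if_neg hj, hP]
        congr 1
        exact Finset.prod_congr rfl fun i hi => by rw [if_pos hi]
      rw [← h2] at h1
      have h3 := hx.mem_powIdeal_of_prod_mul _ (Finset.subset_univ _)
        (fun i _ => by split_ifs <;> omega) h1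
      have h4 : c ∈ (unifPowIdeal x s ⊔ Ideal.span {P * x j ^ (s - t)}).colon {P} := by
        refine powIdeal_le (fun i _ => ?_) h3
        rw [Submodule.mem_colon_singleton, smul_eq_mul]
        by_cases hij : i = j
        · subst hij
          refine Ideal.mem_sup_right (Ideal.mem_span_singleton'.2 ⟨1, ?_⟩)
          simp [hj]; ring
        · refine Ideal.mem_sup_left (Ideal.mem_of_dvd _ ?_ (pow_mem_powIdeal _ (Finset.mem_univ i)))
          by_cases hiT : i ∈ T
          · have : s - (s - t) = t := by omega
            simp only [Finset.mem_insert, hij, hiT, or_true, if_true, this]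
            calc x i ^ s = x i ^ t * x i ^ (s - t) := by rw [← pow_add]; congr 1; omega
              _ ∣ _ := mul_dvd_mul_left _ (Finset.dvd_prod_of_mem (fun i => x i ^ (s - t)) hiT)
          · simp [Finset.mem_insert, hij, hiT]
      rw [Submodule.mem_colon_singleton, smul_eq_mul, Submodule.mem_sup] at h4
      obtain ⟨u, hu, v, hv, huv⟩ := h4
      obtain ⟨d, rfl⟩ := Ideal.mem_span_singleton'.1 hv
      refine ⟨d, ?_⟩
      rw [Finset.prod_insert hj]
      have : r - x j ^ (s - t) * P * d = (r - P * c) + u := by linear_combination -huv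
      rw [this]
      exact Ideal.add_mem _ hc hu
  obtain ⟨c, hc⟩ := key Finset.univ
  exact ⟨c, by rwa [← Finset.prod_pow]⟩

end MonomialIdeals

/-! ### Top local cohomology and its Frobenius action -/

/-- The data making `E` behave like the injective hull of the residue field: `E` is the directed
union of the cyclic submodules `R • y t ≅ R / I t`, and `R • y t` is the full annihilator of `I t`
in `E`, where the ideals `I t` are cofinal with the powers of the maximal ideal `I 1`. -/
structure IsInverseSystem {R E : Type*} [CommRing R] [IsLocalRing R] [AddCommGroup E] [Module R E]
    (I : ℕ → Ideal R) (y : ℕ → E) : Prop where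
  exists_eq_smul : ∀ z : E, ∃ t, ∀ s ≥ t, ∃ r : R, z = r • y s
  smul_eq_zero_iff : ∀ t (r : R), r • y t = 0 ↔ r ∈ I t
  mem_of_annihilated : ∀ t (z : E), (∀ r ∈ I t, r • z = 0) → ∃ r : R, z = r • y t
  one_eq : I 1 = maximalIdeal R
  le_pow : ∀ t, I t ≤ maximalIdeal R ^ t
  pow_le : ∀ t, ∃ N, maximalIdeal R ^ N ≤ I t

section TopLocalCohomology

variable {R : Type*} [CommRing R] {ι : Type*} [Fintype ι]

/-- Fractions `r / X ^ N` with `X = ∏ x i` and `r ∈ (x i ^ N)`: the sum of the images of the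
localizations of `R` at the products of all but one of the `x i`. -/
def cechBoundary (x : ι → R) : Submodule R (Localization.Away (∏ i, x i)) where
  carrier := {z | ∃ N, ∃ r ∈ unifPowIdeal x N, (∏ i, x i) ^ N • z = algebraMap R _ r}
  add_mem' := by
    rintro a b ⟨N, r, hr, ha⟩ ⟨M, s, hs, hb⟩
    refine ⟨N + M, (∏ i, x i) ^ M * r + (∏ i, x i) ^ N * s, Ideal.add_mem _
      (prod_pow_mul_mem_unifPowIdeal M hr) ?_, ?_⟩
    · rw [add_comm N M]
      exact prod_pow_mul_mem_unifPowIdeal N hs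
    · rw [smul_add, pow_add, mul_smul, mul_smul, smul_comm, ha, hb, map_add, map_mul, map_mul,
        Algebra.smul_def, Algebra.smul_def]
  zero_mem' := ⟨0, 0, Ideal.zero_mem _, by simp⟩
  smul_mem' := by
    rintro c a ⟨N, r, hr, ha⟩
    refine ⟨N, c * r, Ideal.mul_mem_left _ _ hr, ?_⟩
    rw [smul_comm, ha, map_mul, Algebra.smul_def]

/-- The top local cohomology module `Hⁿ_(x)(R)`, as the last cohomology of the Čech complex. -/
abbrev TopLocalCohomology (x : ι → R) : Type _ :=
  Localization.Away (∏ i, x i) ⧸ cechBoundary x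

/-- The class of `1 / (x₁ ⋯ xₙ) ^ t`. -/
noncomputable def cechClass (x : ι → R) (t : ℕ) : TopLocalCohomology x :=
  (cechBoundary x).mkQ (IsLocalization.Away.invSelf (∏ i, x i) ^ t)

theorem prod_pow_smul_invSelf_pow (x : ι → R) (t : ℕ) :
    (∏ i, x i) ^ t • (IsLocalization.Away.invSelf (∏ i, x i) ^ t :
      Localization.Away (∏ i, x i)) = 1 := by
  rw [Algebra.smul_def, map_pow, ← mul_pow, IsLocalization.Away.mul_invSelf, one_pow]

theorem prod_pow_smul_cechClass (x : ι → R) (t k : ℕ) :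
    (∏ i, x i) ^ k • cechClass x (t + k) = cechClass x t := by
  rw [cechClass, cechClass, ← map_smul, pow_add, mul_comm, ← smul_mul_assoc,
    prod_pow_smul_invSelf_pow, one_mul]

theorem exists_eq_smul_cechClass (x : ι → R) (z : TopLocalCohomology x) :
    ∃ t, ∀ s ≥ t, ∃ r : R, z = r • cechClass x s := by
  obtain ⟨z, rfl⟩ := (cechBoundary x).mkQ_surjective z
  obtain ⟨n, a, h⟩ := IsLocalization.Away.surj (∏ i, x i) z
  refine ⟨n, fun s hs => ⟨(∏ i, x i) ^ (s - n) * a, ?_⟩⟩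
  obtain ⟨k, rfl⟩ := Nat.exists_eq_add_of_le hs
  rw [Nat.add_sub_cancel_left, mul_comm, mul_smul, prod_pow_smul_cechClass, cechClass, ← map_smul]
  congr 1
  rw [Algebra.smul_def, ← h, mul_assoc, ← map_pow, ← Algebra.smul_def, prod_pow_smul_invSelf_pow,
    mul_one]

theorem IsPermRegular.prod_mem_nonZeroDivisors {x : ι → R} (hx : IsPermRegular x) :
    ∏ i, x i ∈ nonZeroDivisors R := by
  refine prod_mem fun i _ => mem_nonZeroDivisors_iff_right.2 fun r hr => ?_
  have := hx ∅ i (Finset.notMem_empty _) r (by simpa [mul_comm] using hr)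
  simpa using this

theorem IsPermRegular.algebraMap_injective {x : ι → R} (hx : IsPermRegular x) :
    Function.Injective (algebraMap R (Localization.Away (∏ i, x i))) :=
  IsLocalization.injective _ (Submonoid.powers_le.2 hx.prod_mem_nonZeroDivisors)

/-- The annihilator of the class of `1 / (x₁ ⋯ xₙ) ^ t` is `(x₁ᵗ, …, xₙᵗ)`. -/
theorem IsPermRegular.smul_cechClass_eq_zero_iff {x : ι → R} (hx : IsPermRegular x) (t : ℕ)
    (r : R) : r • cechClass x t = 0 ↔ r ∈ unifPowIdeal x t := by
  classical
  rw [cechClass, ← map_smul, Submodule.mkQ_apply, Submodule.Quotient.mk_eq_zero]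
  constructor
  · rintro ⟨N, a, ha, h⟩
    have h1 : (∏ i, x i) ^ N * r = (∏ i, x i) ^ t * a := by
      refine hx.algebraMap_injective ?_
      have h2 := prod_pow_smul_invSelf_pow x t
      rw [Algebra.smul_def] at h h2
      rw [Algebra.smul_def] at h
      rw [map_mul, map_mul, ← h]
      linear_combination -(algebraMap R (Localization.Away (∏ i, x i)) ((∏ i, x i) ^ N) *
        algebraMap R _ r) * h2
    refine hx.mem_unifPowIdeal_of_prod_pow_mul (k := N) ?_
    rw [h1, add_comm]
    exact prod_pow_mul_mem_unifPowIdeal t ha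
  · intro h
    refine ⟨t, r, h, ?_⟩
    rw [smul_comm, prod_pow_smul_invSelf_pow, Algebra.smul_def, mul_one]

/-- The elements killed by `(x₁ᵗ, …, xₙᵗ)` are the multiples of the class of `1 / (x₁ ⋯ xₙ) ^ t`;
this is the computation of the colon ideals `(x₁ˢ, …, xₙˢ) : (x₁ᵗ, …, xₙᵗ)`. -/
theorem IsPermRegular.exists_eq_smul_of_annihilated {x : ι → R} (hx : IsPermRegular x) (t : ℕ)
    (z : TopLocalCohomology x) (h : ∀ r ∈ unifPowIdeal x t, r • z = 0) :
    ∃ r : R, z = r • cechClass x t := by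
  classical
  obtain ⟨t', ht'⟩ := exists_eq_smul_cechClass x z
  obtain ⟨r, rfl⟩ := ht' (t + t') (Nat.le_add_left _ _)
  obtain ⟨c, hc⟩ := hx.mem_sup_of_forall_pow_mul (r := r) (Nat.le_add_right t t') fun i => by
    rw [← hx.smul_cechClass_eq_zero_iff, mul_smul]
    exact h _ (pow_mem_powIdeal _ (Finset.mem_univ i))
  refine ⟨c, ?_⟩
  rw [← hx.smul_cechClass_eq_zero_iff, sub_smul, sub_eq_zero, Nat.add_sub_cancel_left,
    mul_comm, mul_smul, prod_pow_smul_cechClass] at hc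
  exact hc

theorem IsPermRegular.isInverseSystem [IsLocalRing R] {x : ι → R} (hx : IsPermRegular x)
    (hm : Ideal.span (Set.range x) = maximalIdeal R) :
    IsInverseSystem (unifPowIdeal x) (cechClass x) where
  exists_eq_smul := exists_eq_smul_cechClass x
  smul_eq_zero_iff := hx.smul_cechClass_eq_zero_iff
  mem_of_annihilated := hx.exists_eq_smul_of_annihilated
  one_eq := by rw [← hm]; simp [unifPowIdeal, powIdeal]
  le_pow t := powIdeal_le fun i _ => Ideal.pow_mem_pow (hm ▸ Ideal.subset_span ⟨i, rfl⟩) _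
  pow_le t := by
    refine Ideal.exists_pow_le_of_le_radical_of_fg ?_ ?_
    · rw [← hm, Ideal.span_le]
      rintro _ ⟨i, rfl⟩
      exact ⟨t, pow_mem_powIdeal _ (Finset.mem_univ i)⟩
    · rw [← hm]
      exact Submodule.fg_span (Set.finite_range x)

variable (p : ℕ) [Fact p.Prime] [CharP R p]

/-- The Frobenius endomorphism of the localization, as a semilinear map. -/
noncomputable def locFrobenius (x : ι → R) [CharP (Localization.Away (∏ i, x i)) p] :
    Localization.Away (∏ i, x i) →ₛₗ[frobenius R p] Localization.Away (∏ i, x i) where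
  toFun z := z ^ p
  map_add' a b := add_pow_char _ _ _
  map_smul' r a := by rw [smul_pow, frobenius_def]

theorem cechBoundary_le_comap (x : ι → R) [CharP (Localization.Away (∏ i, x i)) p] :
    cechBoundary x ≤ (cechBoundary x).comap (locFrobenius p x) := by
  rintro z ⟨N, r, hr, hz⟩
  refine ⟨N * p, r ^ p, ?_, ?_⟩
  · have : unifPowIdeal x N ≤ (unifPowIdeal x (N * p)).comap (frobenius R p) :=
      powIdeal_le fun i _ => by
        rw [Ideal.mem_comap, frobenius_def, ← pow_mul]
        exact pow_mem_powIdeal (fun _ => N * p) (Finset.mem_univ i)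
    exact this hr
  · change _ • z ^ p = _
    rw [pow_mul, ← smul_pow, hz, map_pow]

/-- The Frobenius action on top local cohomology. -/
noncomputable def cechFrobenius (x : ι → R) [CharP (Localization.Away (∏ i, x i)) p] :
    TopLocalCohomology x →ₛₗ[frobenius R p] TopLocalCohomology x :=
  Submodule.mapQ _ _ (locFrobenius p x) (cechBoundary_le_comap p x)

theorem cechFrobenius_cechClass (x : ι → R) [CharP (Localization.Away (∏ i, x i)) p] (t : ℕ) :
    cechFrobenius p x (cechClass x t) = cechClass x (t * p) := by
  rw [cechFrobenius, cechClass, cechClass, Submodule.mkQ_apply, Submodule.mapQ_apply,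
    Submodule.mkQ_apply, pow_mul]
  rfl

theorem bracketPower_maximalIdeal [IsLocalRing R] {x : ι → R}
    (hm : Ideal.span (Set.range x) = maximalIdeal R) (e : ℕ) :
    FPureThreshold.bracketPower (maximalIdeal R) (p ^ e) = unifPowIdeal x (p ^ e) := by
  have : FPureThreshold.bracketPower (maximalIdeal R) (p ^ e) =
      (maximalIdeal R).map (iterateFrobenius R p e) := by
    rw [FPureThreshold.bracketPower, Ideal.map]
    congr 1
  rw [this, ← hm, Ideal.map_span, unifPowIdeal, powIdeal, ← Set.range_comp]
  simp [Function.comp_def, iterateFrobenius_def]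

end TopLocalCohomology

/-! ### Artinian and injective modules over a local ring -/

section Artinian

variable {R M : Type*} [CommRing R] [AddCommGroup M] [Module R M]

/-- A dual form of Hilbert's basis theorem: if every element of `M` is killed by a power of `x` and
the kernel of `x` on `M` is Artinian, then `M` is Artinian. A submodule `N` is controlled by the
submodules `x ^ j (N ∩ ker x ^ (j + 1))` of `ker x`, which decrease with `j`. -/
theorem isArtinian_of_isArtinian_ker (x : R) (hnil : ∀ m : M, ∃ n : ℕ, x ^ n • m = 0)
    [hart : IsArtinian R (LinearMap.ker (LinearMap.lsmul R M x))] : IsArtinian R M := by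
  set K := LinearMap.ker (LinearMap.lsmul R M x) with hK
  have hKmem : ∀ z : M, z ∈ K ↔ x • z = 0 := fun z => by simp [hK]
  -- the part of `ker x` of the form `x ^ j • m` with `m ∈ N`
  let V : ℕ → Submodule R M → Submodule R K := fun j N =>
    (N.map (LinearMap.lsmul R M (x ^ j))).comap K.subtype
  have hV : ∀ j N (z : K), z ∈ V j N ↔ ∃ m ∈ N, x ^ j • m = z := fun j N z => by
    simp [V]
  rw [← monotone_stabilizes_iff_artinian]
  intro g
  set f : ℕ → Submodule R M := fun n => OrderDual.ofDual (g n) with hfdef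
  have hf : ∀ {m n : ℕ}, m ≤ n → f n ≤ f m := fun h => g.monotone h
  have hVanti : ∀ {j j' n n' : ℕ}, j ≤ j' → n ≤ n' → V j' (f n') ≤ V j (f n) := by
    intro j j' n n' hj hn z hz
    obtain ⟨m, hm, hmz⟩ := (hV _ _ _).1 hz
    obtain ⟨k, rfl⟩ := Nat.exists_eq_add_of_le hj
    exact (hV _ _ _).2 ⟨x ^ k • m, (f n).smul_mem _ (hf hn hm), by rw [← mul_smul, ← pow_add, hmz]⟩
  obtain ⟨_, ⟨⟨j₀, n₀⟩, rfl⟩, hmin⟩ := IsArtinian.set_has_minimal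
    (Set.range fun q : ℕ × ℕ => V q.1 (f q.2)) ⟨_, (0, 0), rfl⟩
  have hst : ∀ j, ∃ N, ∀ n ≥ N, V j (f n) = V j (f N) := by
    intro j
    obtain ⟨_, ⟨N, rfl⟩, hminj⟩ := IsArtinian.set_has_minimal
      (Set.range fun n : ℕ => V j (f n)) ⟨_, 0, rfl⟩
    exact ⟨N, fun n hn => (hVanti le_rfl hn).eq_of_not_lt (hminj _ ⟨n, rfl⟩)⟩
  choose N hN using hst
  let n₁ := max n₀ ((Finset.range j₀).sup N)
  have hall : ∀ j, ∀ n ≥ n₁, V j (f n) = V j (f n₁) := by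
    intro j n hn
    by_cases hj : j < j₀
    · have h1 : N j ≤ n₁ := le_max_of_le_right (Finset.le_sup (Finset.mem_range.2 hj))
      rw [hN j n (h1.trans hn), hN j n₁ h1]
    · push Not at hj
      have h2 : ∀ n ≥ n₀, V j (f n) = V j₀ (f n₀) := fun n hn =>
        (hVanti hj hn).eq_of_not_lt (hmin _ ⟨(j, n), rfl⟩)
      rw [h2 n ((le_max_left _ _).trans hn), h2 n₁ (le_max_left _ _)]
  refine ⟨n₁, fun n hn => (le_antisymm ?_ (hf hn) : f n₁ = f n)⟩
  -- correct `m` by an element of `f n` to lower the power of `x` killing it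
  have key : ∀ k : ℕ, ∀ m ∈ f n₁, x ^ k • m = 0 → m ∈ f n := by
    intro k
    induction k with
    | zero => intro m _ h; rw [pow_zero, one_smul] at h; rw [h]; exact zero_mem _
    | succ k ih =>
      intro m hm h
      have hz : x ^ k • m ∈ K := (hKmem _).2 (by rwa [← mul_smul, ← pow_succ'])
      have h1 : (⟨_, hz⟩ : K) ∈ V k (f n₁) := (hV _ _ _).2 ⟨m, hm, rfl⟩
      rw [← hall k n hn] at h1
      obtain ⟨m', hm', hmm'⟩ := (hV _ _ _).1 h1
      have h2 := ih (m - m') (sub_mem hm (hf hn hm')) (by rw [smul_sub, hmm', sub_self])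
      simpa using add_mem h2 hm'
  intro m hm
  obtain ⟨k, hk⟩ := hnil m
  exact key k m hm hk

/-- A module on which each of finitely many elements acts locally nilpotently is Artinian as soon as
the submodule killed by all of these elements is. -/
theorem isArtinian_of_isArtinian_torsionBySet (s : Finset R)
    (hnil : ∀ x ∈ s, ∀ m : M, ∃ n : ℕ, x ^ n • m = 0)
    (hart : IsArtinian R (Submodule.torsionBySet R M (s : Set R))) : IsArtinian R M := by
  classical
  induction s using Finset.induction_on with
  | empty =>
    have : Submodule.torsionBySet R M ((∅ : Finset R) : Set R) = ⊤ := by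
      ext m; simp [Submodule.mem_torsionBySet_iff]
    rw [this] at hart
    exact isArtinian_of_linearEquiv (Submodule.topEquiv (R := R) (M := M))
  | insert x s hx ih =>
    refine ih (fun y hy => hnil y (Finset.mem_insert_of_mem hy)) ?_
    set M' := Submodule.torsionBySet R M (s : Set R) with hM'
    have hk : ∀ z : LinearMap.ker (LinearMap.lsmul R M' x), z.1.1 ∈
        Submodule.torsionBySet R M ((insert x s : Finset R) : Set R) := by
      rintro ⟨⟨m, hm⟩, hxm⟩
      rw [Submodule.mem_torsionBySet_iff] at hm ⊢
      rintro ⟨a, ha⟩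
      rcases Finset.mem_insert.1 ha with rfl | ha
      · exact congrArg Subtype.val (LinearMap.mem_ker.1 hxm)
      · exact hm ⟨a, ha⟩
    have : IsArtinian R (LinearMap.ker (LinearMap.lsmul R M' x)) :=
      isArtinian_of_injective (LinearMap.codRestrict (Submodule.torsionBySet R M
        ((insert x s : Finset R) : Set R)) (M'.subtype ∘ₗ Submodule.subtype _) hk) (by
          intro a b hab
          have h : a.1.1 = b.1.1 := by
            have := congrArg (Submodule.subtype _) hab
            exact this
          exact Subtype.ext (Subtype.ext h))
    refine isArtinian_of_isArtinian_ker x fun m => ?_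
    obtain ⟨n, hn⟩ := hnil x (Finset.mem_insert_self _ _) m
    exact ⟨n, Subtype.ext hn⟩

end Artinian

/-- The kernel of restriction along `i : N → M` on `Hom(M, E)` consists of maps that factor through
the cokernel of `i`. -/
theorem Module.length_linearMap_le_add {R M E : Type*} [CommRing R] [AddCommGroup E] [Module R E]
    [AddCommGroup M] [Module R M] {N : Type*} [AddCommGroup N]
    [Module R N] (i : N →ₗ[R] M) :
    Module.length R (M →ₗ[R] E) ≤ Module.length R (M ⧸ LinearMap.range i →ₗ[R] E) +
      Module.length R (LinearMap.range (LinearMap.lcomp R E i)) := by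
  rw [Module.length_eq_add_of_exact (LinearMap.ker (LinearMap.lcomp R E i)).subtype
    (LinearMap.lcomp R E i).rangeRestrict (Submodule.subtype_injective _)
    (LinearMap.surjective_rangeRestrict _) (by
      rw [LinearMap.exact_iff]; simp)]
  gcongr
  refine Module.length_le_of_surjective (((LinearMap.lcomp R E
    (LinearMap.range i).mkQ)).codRestrict _ fun g => ?_) ?_
  · rw [LinearMap.mem_ker]
    ext n
    have : (LinearMap.range i).mkQ (i n) = 0 := (Submodule.Quotient.mk_eq_zero _).2 ⟨n, rfl⟩
    simp only [LinearMap.lcomp_apply, this, map_zero, LinearMap.zero_apply]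
  · rintro ⟨g, hg⟩
    have hle : LinearMap.range i ≤ LinearMap.ker g := by
      rintro _ ⟨n, rfl⟩
      exact LinearMap.congr_fun (LinearMap.mem_ker.1 hg) n
    exact ⟨(LinearMap.range i).liftQ g hle, Subtype.ext (Submodule.liftQ_mkQ _ _ hle)⟩

namespace IsInverseSystem

universe v

variable {R : Type*} {E : Type v} [CommRing R] [IsLocalRing R] [AddCommGroup E] [Module R E]
  {I : ℕ → Ideal R} {y : ℕ → E}

/-- The embedding `R / I t → E` with image `R • y t`. -/
def quotHom (H : IsInverseSystem I y) (t : ℕ) : (R ⧸ I t) →ₗ[R] E :=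
  (I t).liftQ (LinearMap.toSpanSingleton R E (y t)) fun r hr => by
    simpa using (H.smul_eq_zero_iff t r).2 hr

theorem quotHom_mk (H : IsInverseSystem I y) (t : ℕ) (r : R) :
    H.quotHom t (Submodule.Quotient.mk r) = r • y t := rfl

theorem quotHom_injective (H : IsInverseSystem I y) (t : ℕ) :
    Function.Injective (H.quotHom t) := by
  rw [injective_iff_map_eq_zero]
  intro a ha
  obtain ⟨r, rfl⟩ := Submodule.Quotient.mk_surjective _ a
  rw [quotHom_mk, H.smul_eq_zero_iff] at ha
  exact (Submodule.Quotient.mk_eq_zero _).2 ha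

theorem isSimpleModule_quot (H : IsInverseSystem I y) : IsSimpleModule R (R ⧸ I 1) := by
  rw [H.one_eq]
  exact isSimpleModule_iff_quot_maximal.2 ⟨_, inferInstance, ⟨LinearEquiv.refl _ _⟩⟩

theorem exists_pow_smul_eq_zero (H : IsInverseSystem I y) (z : E) :
    ∃ N, ∀ r ∈ maximalIdeal R ^ N, r • z = 0 := by
  obtain ⟨t, ht⟩ := H.exists_eq_smul z
  obtain ⟨a, rfl⟩ := ht t le_rfl
  obtain ⟨N, hN⟩ := H.pow_le t
  refine ⟨N, fun r hr => ?_⟩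
  rw [smul_comm, (H.smul_eq_zero_iff t r).2 (hN hr), smul_zero]

/-- `E` is Artinian: its elements are `𝔪`-power torsion and its socle `R • y 1` is simple. -/
theorem isArtinian [IsNoetherianRing R] (H : IsInverseSystem I y) : IsArtinian R E := by
  obtain ⟨s, hs⟩ := IsNoetherian.noetherian (maximalIdeal R)
  refine isArtinian_of_isArtinian_torsionBySet s (fun x hx z => ?_) ?_
  · obtain ⟨N, hN⟩ := H.exists_pow_smul_eq_zero z
    refine ⟨N, hN _ (Ideal.pow_mem_pow ?_ _)⟩
    rw [← hs]
    exact Submodule.subset_span hx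
  · have := H.isSimpleModule_quot
    have h1 : IsArtinian R (LinearMap.range (H.quotHom 1)) := isArtinian_range _
    refine isArtinian_of_le (t := LinearMap.range (H.quotHom 1)) fun z hz => ?_
    obtain ⟨r, hr⟩ := H.mem_of_annihilated 1 z fun r hr => by
      have h2 : maximalIdeal R ≤ LinearMap.ker (LinearMap.toSpanSingleton R E z) := by
        rw [← hs, Submodule.span_le]
        exact fun a ha => (Submodule.mem_torsionBySet_iff _ _).1 hz ⟨a, ha⟩
      exact h2 (H.one_eq ▸ hr)
    exact ⟨Submodule.Quotient.mk r, by rw [quotHom_mk, hr]⟩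

theorem length_hom_quot_one_le (H : IsInverseSystem I y) :
    Module.length R ((R ⧸ I 1) →ₗ[R] E) ≤ 1 := by
  have := H.isSimpleModule_quot
  rw [← Module.length_eq_one R (R ⧸ I 1)]
  have h1 : Module.length R (LinearMap.range (H.quotHom 1)) ≤ Module.length R (R ⧸ I 1) :=
    Module.length_le_of_surjective _ (LinearMap.surjective_rangeRestrict (H.quotHom 1))
  refine le_trans ?_ h1
  refine Module.length_le_of_injective ((LinearMap.applyₗ
    (Submodule.Quotient.mk 1 : R ⧸ I 1)).codRestrict _ fun g => ?_) fun g g' h => ?_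
  · obtain ⟨r, hr⟩ := H.mem_of_annihilated 1 (g (Submodule.Quotient.mk 1)) fun r hr => by
      rw [← map_smul, ← Submodule.Quotient.mk_smul, (Submodule.Quotient.mk_eq_zero _).2, map_zero]
      simpa using hr
    exact ⟨Submodule.Quotient.mk r, by rw [quotHom_mk]; exact hr.symm⟩
  · refine Submodule.linearMap_qext _ (LinearMap.ext_ring ?_)
    exact congrArg Subtype.val h

/-- Since `Hom(k, E)` has length at most one for the residue field `k`, the functor `Hom(-, E)` does
not increase lengths. -/
theorem length_hom_le (H : IsInverseSystem I y) {M : Type*} [AddCommGroup M] [Module R M]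
    (hM : IsFiniteLength R M) : Module.length R (M →ₗ[R] E) ≤ Module.length R M := by
  induction hM with
  | of_subsingleton => simp
  | @of_simple_quotient M _ _ N hS hN ih =>
    have h1 := Module.length_linearMap_le_add (E := E) N.subtype
    have h2 : Module.length R (LinearMap.range (LinearMap.lcomp R E N.subtype)) ≤
        Module.length R (N →ₗ[R] E) :=
      Module.length_le_of_injective (Submodule.subtype _) (Submodule.subtype_injective _)
    have h3 : Module.length R (M ⧸ LinearMap.range N.subtype →ₗ[R] E) ≤ 1 := by
      obtain ⟨J, hJ, ⟨e⟩⟩ := isSimpleModule_iff_quot_maximal.1 hS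
      have hJ' : J = I 1 := by rw [H.one_eq]; exact IsLocalRing.eq_maximalIdeal hJ
      subst hJ'
      have e' : (M ⧸ LinearMap.range N.subtype) ≃ₗ[R] (R ⧸ I 1) :=
        (Submodule.quotEquivOfEq _ _ N.range_subtype).trans e
      rw [(e'.congrLeft E R).length_eq]
      exact H.length_hom_quot_one_le
    rw [Module.length_eq_add_of_exact N.subtype N.mkQ (Submodule.subtype_injective _)
      N.mkQ_surjective (LinearMap.exact_subtype_mkQ N), Module.length_eq_one R (M ⧸ N)]
    calc _ ≤ _ := h1
      _ ≤ 1 + Module.length R N := add_le_add h3 (h2.trans ih)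
      _ = _ := add_comm _ _

theorem isFiniteLength_quot [IsNoetherianRing R] (H : IsInverseSystem I y) (t : ℕ) :
    IsFiniteLength R (R ⧸ I t) := by
  have := H.isArtinian
  exact isFiniteLength_iff_isNoetherian_isArtinian.2
    ⟨inferInstance, isArtinian_of_injective _ (H.quotHom_injective t)⟩

/-- `E` is injective relative to the modules `R / I t`: the restriction map on `Hom(-, E)` is onto,
since its image has at least the length of its target. -/
theorem exists_extension_quot [IsNoetherianRing R] (H : IsInverseSystem I y) (t : ℕ)
    {N : Type*} [AddCommGroup N] [Module R N] (i : N →ₗ[R] (R ⧸ I t))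
    (hi : Function.Injective i) (g : N →ₗ[R] E) : ∃ h : (R ⧸ I t) →ₗ[R] E, h ∘ₗ i = g := by
  have hfin := H.isFiniteLength_quot t
  have hfin' := isFiniteLength_iff_isNoetherian_isArtinian.1 hfin
  have := hfin'.1
  have := hfin'.2
  have hNfin : IsFiniteLength R N := isFiniteLength_iff_isNoetherian_isArtinian.2
    ⟨isNoetherian_of_injective i hi, isArtinian_of_injective i hi⟩
  have hQfin : IsFiniteLength R ((R ⧸ I t) ⧸ LinearMap.range i) :=
    isFiniteLength_iff_isNoetherian_isArtinian.2 ⟨inferInstance, inferInstance⟩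
  have h1 := Module.length_linearMap_le_add (E := E) i
  have h2 := H.length_hom_le hQfin
  have h3 := H.length_hom_le hNfin
  have h4 : Module.length R (R ⧸ I t) ≤ Module.length R ((R ⧸ I t) →ₗ[R] E) := by
    refine Module.length_le_of_injective
      ((LinearMap.compRight R (H.quotHom t)) ∘ₗ (LinearMap.mul R (R ⧸ I t))) fun a b hab => ?_
    have := LinearMap.congr_fun hab 1
    exact H.quotHom_injective t (by simpa using this)
  have h5 : Module.length R (R ⧸ I t) = Module.length R N +
      Module.length R ((R ⧸ I t) ⧸ LinearMap.range i) :=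
    Module.length_eq_add_of_exact i (LinearMap.range i).mkQ hi (Submodule.mkQ_surjective _)
      (LinearMap.exact_map_mkQ_range i)
  have hQne := Module.length_ne_top_iff.2 hQfin
  have h6 : Module.length R N ≤ Module.length R (LinearMap.range (LinearMap.lcomp R E i)) := by
    rw [h5] at h4
    have h7 := (h4.trans h1).trans (add_le_add_left h2 _)
    rw [add_comm] at h7
    exact (ENat.add_le_add_iff_left hQne).1 h7
  have hHom : Module.length R (N →ₗ[R] E) ≠ ⊤ :=
    ne_top_of_le_ne_top (Module.length_ne_top_iff.2 hNfin) h3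
  have hHom' := isFiniteLength_iff_isNoetherian_isArtinian.1 (Module.length_ne_top_iff.1 hHom)
  have := hHom'.1
  have := hHom'.2
  have htop : LinearMap.range (LinearMap.lcomp R E i) = ⊤ := by
    by_contra hne
    exact absurd (Submodule.length_lt hne) (not_lt.2 (h3.trans h6))
  have hg : g ∈ LinearMap.range (LinearMap.lcomp R E i) := htop ▸ Submodule.mem_top
  exact hg

/-- `E` is an injective module. By the Artin–Rees lemma, a map from an ideal `J` to `E` factors
through the image of `J` in some `R / I t`. -/
theorem baer [IsNoetherianRing R] (H : IsInverseSystem I y) : Module.Baer R E := by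
  intro J g
  -- a power of `𝔪` kills the image of `g`
  obtain ⟨N, hN⟩ : ∃ N, ∀ a : J, ∀ r ∈ maximalIdeal R ^ N, r • g a = 0 := by
    obtain ⟨s, hs⟩ := (isNoetherian_def.1 (inferInstance : IsNoetherian R J)) ⊤
    choose n hn using fun a => H.exists_pow_smul_eq_zero (g a)
    refine ⟨s.sup n, fun a r hr => ?_⟩
    have h1 : (⊤ : Submodule R J) ≤ LinearMap.ker (r • g) := by
      rw [← hs, Submodule.span_le]
      intro b hb
      exact hn b r (Ideal.pow_le_pow_right (Finset.le_sup hb) hr)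
    exact LinearMap.mem_ker.1 (h1 (Submodule.mem_top (x := a)))
  obtain ⟨k, hk⟩ := Ideal.exists_pow_inf_eq_pow_smul (maximalIdeal R) J
  have hker : ∀ a : J, (a : R) ∈ I (k + N) → g a = 0 := by
    rintro ⟨a, ha⟩ haI
    have h1 : a ∈ maximalIdeal R ^ N • (maximalIdeal R ^ k • ⊤ ⊓ J : Ideal R) := by
      have h2 := hk (k + N) (Nat.le_add_right _ _)
      rw [Nat.add_sub_cancel_left] at h2
      rw [← h2]
      exact ⟨by simpa using H.le_pow _ haI, ha⟩
    have h3 : maximalIdeal R ^ N • (maximalIdeal R ^ k • ⊤ ⊓ J : Ideal R) ≤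
        (LinearMap.ker g).map J.subtype := by
      refine Submodule.smul_le.2 fun r hr b hb => ?_
      exact ⟨r • ⟨b, hb.2⟩, by rw [SetLike.mem_coe, LinearMap.mem_ker, map_smul]; exact hN _ r hr,
        rfl⟩
    obtain ⟨b, hb, hba⟩ := h3 h1
    have : b = ⟨a, ha⟩ := Subtype.ext hba
    rw [← this]
    exact hb
  set C : Submodule R J := Submodule.comap J.subtype (I (k + N)) with hC
  have hi : Function.Injective (Submodule.mapQ C (I (k + N)) J.subtype le_rfl) := by
    rw [← LinearMap.ker_eq_bot, Submodule.mapQ, Submodule.ker_liftQ_eq_bot]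
    rw [LinearMap.ker_comp, Submodule.ker_mkQ]
  obtain ⟨h, hh⟩ := H.exists_extension_quot (k + N) _ hi (C.liftQ g fun a ha => hker a ha)
  refine ⟨h ∘ₗ (I (k + N)).mkQ, fun a ha => ?_⟩
  have := LinearMap.congr_fun hh (Submodule.Quotient.mk ⟨a, ha⟩)
  exact this

end IsInverseSystem

/-! ### The endomorphism ring in place of the completion -/

namespace IsInverseSystem

universe v

variable {R : Type*} {E : Type v} [CommRing R] [IsLocalRing R] [AddCommGroup E] [Module R E]
  {I : ℕ → Ideal R} {y : ℕ → E}

theorem class_one_ne_zero (H : IsInverseSystem I y) : y 1 ≠ 0 := by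
  intro h
  have h1 : (1 : R) ∈ I 1 := (H.smul_eq_zero_iff 1 1).1 (by rw [h, smul_zero])
  rw [H.one_eq] at h1
  exact (Ideal.ne_top_iff_one _).1 (IsLocalRing.maximalIdeal.isMaximal R).ne_top h1

/-- `E` is a cogenerator: elements outside a submodule are detected by endomorphisms of `E` killing
the submodule. -/
theorem exists_end_apply_ne_zero [IsNoetherianRing R] (H : IsInverseSystem I y)
    (N : Submodule R E) {z : E} (hz : z ∉ N) :
    ∃ φ : Module.End R E, (∀ n ∈ N, φ n = 0) ∧ φ z ≠ 0 := by
  have hz' : N.mkQ z ≠ 0 := fun h => hz ((Submodule.Quotient.mk_eq_zero _).1 h)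
  have hle : Ideal.torsionOf R (E ⧸ N) (N.mkQ z) ≤
      LinearMap.ker (LinearMap.toSpanSingleton R E (y 1)) := by
    intro r hr
    rw [LinearMap.mem_ker, LinearMap.toSpanSingleton_apply, H.smul_eq_zero_iff, H.one_eq]
    refine IsLocalRing.le_maximalIdeal (fun h => ?_) hr
    exact hz' ((Ideal.torsionOf_eq_top_iff _ _).1 h)
  let e := Ideal.quotTorsionOfEquivSpanSingleton R (E ⧸ N) (N.mkQ z)
  obtain ⟨h, hh⟩ := H.baer.extension_property (Submodule.span R {N.mkQ z}).subtype
    (Submodule.subtype_injective _)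
    ((Ideal.torsionOf R (E ⧸ N) (N.mkQ z)).liftQ _ hle ∘ₗ e.symm.toLinearMap)
  refine ⟨h ∘ₗ N.mkQ, fun n hn => ?_, ?_⟩
  · rw [LinearMap.comp_apply, Submodule.mkQ_apply, (Submodule.Quotient.mk_eq_zero _).2 hn, map_zero]
  · have h1 := LinearMap.congr_fun hh ⟨N.mkQ z, Submodule.mem_span_singleton_self _⟩
    have h2 : e (Submodule.Quotient.mk 1) = ⟨N.mkQ z, Submodule.mem_span_singleton_self _⟩ :=
      by
      refine (Ideal.quotTorsionOfEquivSpanSingleton_apply_mk (R := R) (N.mkQ z) 1).trans ?_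
      rw [one_smul]
    rw [← h2] at h1
    simp only [LinearMap.comp_apply, LinearEquiv.coe_coe, LinearEquiv.symm_apply_apply] at h1
    rw [h2] at h1
    rw [LinearMap.comp_apply]
    refine ne_of_eq_of_ne h1 ?_
    change LinearMap.toSpanSingleton R E (y 1) 1 ≠ 0
    simpa using H.class_one_ne_zero

/-- On each of the submodules `R • y t`, which exhaust `E`, an endomorphism of `E` acts as
multiplication by an element of `R`. -/
theorem exists_apply_eq_smul (H : IsInverseSystem I y) (φ : Module.End R E) (t : ℕ) :
    ∃ r : R, ∀ a : R, φ (a • y t) = r • a • y t := by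
  obtain ⟨r, hr⟩ := H.mem_of_annihilated t (φ (y t)) fun r hr => by
    rw [← map_smul, (H.smul_eq_zero_iff t r).2 hr, map_zero]
  exact ⟨r, fun a => by rw [map_smul, hr, smul_comm]⟩

theorem exists_common_level (H : IsInverseSystem I y) (z w : E) :
    ∃ t, (∃ a : R, z = a • y t) ∧ ∃ b : R, w = b • y t := by
  obtain ⟨t, ht⟩ := H.exists_eq_smul z
  obtain ⟨t', ht'⟩ := H.exists_eq_smul w
  exact ⟨max t t', ht _ (le_max_left _ _), ht' _ (le_max_right _ _)⟩

theorem end_mul_comm (H : IsInverseSystem I y) (φ ψ : Module.End R E) : φ * ψ = ψ * φ := by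
  ext z
  obtain ⟨t, ⟨a, rfl⟩, -⟩ := H.exists_common_level z z
  obtain ⟨r, hr⟩ := H.exists_apply_eq_smul φ t
  obtain ⟨s, hs⟩ := H.exists_apply_eq_smul ψ t
  rw [Module.End.mul_apply, Module.End.mul_apply, hr, hs, map_smul, map_smul ψ, hr, hs, smul_comm]

/-- The endomorphism ring of `E` is commutative; it plays the role of the completion of `R`. -/
abbrev endCommRing (H : IsInverseSystem I y) : CommRing (Module.End R E) :=
  { (inferInstance : Ring (Module.End R E)) with mul_comm := H.end_mul_comm }

/-- Endomorphisms killing the common kernel of finitely many endomorphisms lie in the left ideal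
that these generate. -/
theorem mem_span_of_forall_apply_eq_zero [IsNoetherianRing R] (H : IsInverseSystem I y)
    (s : Finset (Module.End R E)) (ψ : Module.End R E)
    (h : ∀ z, (∀ φ ∈ s, φ z = 0) → ψ z = 0) :
    ψ ∈ Submodule.span (Module.End R E) (s : Set (Module.End R E)) := by
  classical
  let Φ : E →ₗ[R] (s → E) := LinearMap.pi fun φ => φ.1
  have hle : LinearMap.ker Φ ≤ LinearMap.ker ψ := fun z hz =>
    h z fun φ hφ => congrFun (LinearMap.mem_ker.1 hz) ⟨φ, hφ⟩
  obtain ⟨χ, hχ⟩ := H.baer.extension_property ((LinearMap.ker Φ).liftQ Φ le_rfl)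
    (LinearMap.ker_eq_bot.1 (Submodule.ker_liftQ_eq_bot _ _ _ le_rfl))
    ((LinearMap.ker Φ).liftQ ψ hle)
  have h1 : ψ = ∑ φ : s, (χ ∘ₗ LinearMap.single R (fun _ : s => E) φ) • φ.1 := by
    ext z
    have h2 := LinearMap.congr_fun hχ (Submodule.Quotient.mk z)
    change χ (Φ z) = ψ z at h2
    rw [← h2, LinearMap.sum_apply]
    conv_lhs => rw [← Finset.univ_sum_single (Φ z), map_sum]
    rfl
  rw [h1]
  exact Submodule.sum_mem _ fun φ _ => Submodule.smul_mem _ _ (Submodule.subset_span φ.2)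

/-- An ideal of the endomorphism ring is determined by finitely many of its elements, whose common
kernel is minimal: the other elements vanish on it. -/
theorem isNoetherianRing_end [IsNoetherianRing R] (H : IsInverseSystem I y) :
    IsNoetherianRing (Module.End R E) := by
  classical
  have := H.isArtinian
  refine isNoetherianRing_iff.2 ⟨fun J => ?_⟩
  -- the common kernel of a finite subset of `J`, chosen minimal
  let K : Finset (Module.End R E) → Submodule R E := fun s => ⨅ φ ∈ s, LinearMap.ker φ
  have hK : ∀ s z, z ∈ K s ↔ ∀ φ ∈ s, φ z = 0 := fun s z => by simp [K]
  obtain ⟨_, ⟨s, hs, rfl⟩, hmin⟩ := IsArtinian.set_has_minimal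
    (K '' {s | (s : Set (Module.End R E)) ⊆ J}) ⟨_, ∅, by simp, rfl⟩
  refine ⟨s, le_antisymm (Submodule.span_le.2 hs) fun φ hφ => ?_⟩
  refine H.mem_span_of_forall_apply_eq_zero s φ fun z hz => ?_
  have hle : K (insert φ s) ≤ K s := fun w hw =>
    (hK _ _).2 fun χ hχ => (hK _ _).1 hw χ (Finset.mem_insert_of_mem hχ)
  have heq : K (insert φ s) = K s := hle.eq_of_not_lt (hmin _ ⟨_, by
    rw [Set.mem_ofPred_eq, Finset.coe_insert, Set.insert_subset_iff]
    exact ⟨hφ, hs⟩, rfl⟩)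
  have hz' : z ∈ K (insert φ s) := heq ▸ (hK _ _).2 hz
  exact (hK _ _).1 hz' φ (Finset.mem_insert_self _ _)

/-- A map that is `q`-semilinear over `R` is `q`-semilinear over the endomorphism ring, because
endomorphisms act locally as elements of `R`. -/
theorem semilinear_end_apply (H : IsInverseSystem I y) {q : ℕ} (F : E →+ E)
    (hF : ∀ (r : R) z, F (r • z) = r ^ q • F z) (φ : Module.End R E) (z : E) :
    F (φ z) = (φ ^ q) (F z) := by
  obtain ⟨t, ⟨a, ha⟩, b, hb⟩ := H.exists_common_level z (F z)
  obtain ⟨r, hr⟩ := H.exists_apply_eq_smul φ t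
  have h1 : ∀ k : ℕ, (φ ^ k) (F z) = r ^ k • F z := by
    intro k
    induction k with
    | zero => simp
    | succ k ih =>
      rw [pow_succ', Module.End.mul_apply, ih, map_smul, hb, hr, pow_succ, mul_smul]
  rw [h1, ha, hr, hF]

/-- A semilinear map that does not kill the socle is injective, as the socle is essential. -/
theorem semilinear_injective (H : IsInverseSystem I y) {q : ℕ} (F : E →+ E)
    (hF : ∀ (r : R) z, F (r • z) = r ^ q • F z) (h1 : F (y 1) ≠ 0) : Function.Injective F := by
  classical
  rw [injective_iff_map_eq_zero]
  intro z hz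
  by_contra hne
  have hex := H.exists_pow_smul_eq_zero z
  have hN := Nat.find_spec hex
  obtain ⟨n, hn⟩ : ∃ n, Nat.find hex = n + 1 := Nat.exists_eq_succ_of_ne_zero fun h0 => by
    rw [h0] at hN
    exact hne (by simpa using hN 1 (by simp))
  have hmin := Nat.find_min hex (m := n) (by omega)
  push Not at hmin
  obtain ⟨r, hr, hrz⟩ := hmin
  obtain ⟨c, hc⟩ := H.mem_of_annihilated 1 (r • z) fun s hs => by
    rw [← mul_smul]
    refine hN _ ?_
    rw [hn, pow_succ']
    exact Ideal.mul_mem_mul (H.one_eq ▸ hs) hr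
  have hcu : IsUnit c := by
    by_contra hcu
    refine hrz ?_
    rw [hc, H.smul_eq_zero_iff, H.one_eq]
    exact hcu
  have h2 : c ^ q • F (y 1) = 0 := by rw [← hF, ← hc, hF, hz, smul_zero]
  exact h1 ((hcu.pow q).smul_eq_zero.1 h2)

end IsInverseSystem

/-! ### The Hartshorne–Speiser–Lyubeznik theorem -/

/-- A descending chain of ideals `A e` in a Noetherian local ring, all containing `c * A 0` for an
ideal `c` with radical `𝔪`, is not strictly descending. -/
theorem exists_eq_succ_of_mul_le {L : Type*} [CommRing L] [IsLocalRing L] [IsNoetherianRing L]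
    (c : Ideal L) (hc : maximalIdeal L ∈ c.minimalPrimes) (A : ℕ → Ideal L) (hA : Antitone A)
    (hcA : ∀ e, c * A 0 ≤ A e) : ∃ e, A (e + 1) = A e := by
  have := IsLocalRing.quotient_artinian_of_mem_minimalPrimes_of_isLocalRing c hc
  let M := A 0 ⧸ (c • ⊤ : Submodule L (A 0))
  have h1 : IsArtinian (L ⧸ c) M := by
    have : Module.Finite (L ⧸ c) M := Module.Finite.of_restrictScalars_finite L (L ⧸ c) M
    exact isArtinian_of_fg_of_artinian'
  have h2 : IsArtinian L M := by
    exact isArtinian_of_surjective_algebraMap (R := L ⧸ c) Ideal.Quotient.mk_surjective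
  let B : ℕ → Submodule L M := fun e =>
    (Submodule.comap (A 0).subtype (A e)).map (Submodule.mkQ _)
  obtain ⟨_, ⟨e, rfl⟩, hmin⟩ := IsArtinian.set_has_minimal (Set.range B) ⟨_, 0, rfl⟩
  have hB : B (e + 1) = B e :=
    (Submodule.map_mono (Submodule.comap_mono (hA (Nat.le_succ e)))).eq_of_not_lt (hmin _ ⟨_, rfl⟩)
  have hle : ∀ e, (c • ⊤ : Submodule L (A 0)) ≤ Submodule.comap (A 0).subtype (A e) := by
    intro e
    refine Submodule.smul_le.2 fun r hr a _ => ?_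
    exact hcA e (Ideal.mul_mem_mul hr a.2)
  refine ⟨e, le_antisymm (hA (Nat.le_succ e)) fun a ha => ?_⟩
  have h3 : Submodule.mkQ (c • ⊤ : Submodule L (A 0)) ⟨a, hA (Nat.zero_le e) ha⟩ ∈ B (e + 1) :=
    hB ▸ ⟨_, ha, rfl⟩
  obtain ⟨a', ha', h4⟩ := h3
  have h5 := hle (e + 1) ((Submodule.Quotient.eq _).1 h4)
  have h6 : (a' : L) - a ∈ A (e + 1) := h5
  simpa using Ideal.sub_mem _ ha' h6

section FrobeniusAction

variable {S E : Type*} [CommRing S] [IsNoetherianRing S] [AddCommGroup E] [Module S E]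

theorem iterate_smul_of_semilinear {S E : Type*} [CommRing S] [AddCommGroup E] [Module S E]
    (θ : E →+ E) {q : ℕ} (hθ : ∀ (s : S) z, θ (s • z) = s ^ q • θ z) (e : ℕ) (s : S) (z : E) :
    θ^[e] (s • z) = s ^ q ^ e • θ^[e] z := by
  induction e with
  | zero => simp
  | succ e ih => rw [Function.iterate_succ_apply', ih, hθ, Function.iterate_succ_apply', ← pow_mul,
      pow_succ]

/-- If submodules are separated by their annihilators, taking annihilators is strictly
order-reversing, and the descending chain condition on `E` follows from the ascending one on
`S`. -/
theorem isArtinian_of_forall_exists_smul_ne_zero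
    (hdual : ∀ (N : Submodule S E) (z : E), z ∉ N → ∃ s : S, (∀ n ∈ N, s • n = 0) ∧ s • z ≠ 0) :
    IsArtinian S E := by
  have hanti : StrictAnti (fun N : Submodule S E => N.annihilator) := by
    intro N N' h
    refine lt_of_le_not_ge (Submodule.annihilator_mono h.le) fun hle => ?_
    obtain ⟨z, hz, hzN⟩ := SetLike.exists_of_lt h
    obtain ⟨s, hs, hsz⟩ := hdual N z hzN
    exact hsz (Submodule.mem_annihilator.1 (hle (Submodule.mem_annihilator.2 hs)) z hz)
  exact hanti.wellFoundedLT

/-- The Hartshorne–Speiser–Lyubeznik theorem: a Frobenius action on a module satisfying Matlis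
duality over a Noetherian ring has bounded nilpotency order.

The annihilators of `ker θᵉ⁺¹ / ker θᵉ` are eventually a constant ideal `b`, and then `b²` maps
every `ker θᵉ` into one fixed kernel. If `b` were proper, localization at a minimal prime of `b`
would turn the annihilators of the kernels into a chain of finite length. -/
theorem exists_iterate_eq_zero_of_semilinear
    (hdual : ∀ (N : Submodule S E) (z : E), z ∉ N → ∃ s : S, (∀ n ∈ N, s • n = 0) ∧ s • z ≠ 0)
    (θ : E →+ E) {q : ℕ} (hq : 2 ≤ q) (hθ : ∀ (s : S) z, θ (s • z) = s ^ q • θ z) :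
    ∃ e, ∀ n z, θ^[n] z = 0 → θ^[e] z = 0 := by
  classical
  let K : ℕ → Submodule S E := fun e =>
    { carrier := {z | θ^[e] z = 0}
      add_mem' := fun {a b} ha hb => by
        rw [Set.mem_ofPred_eq] at ha hb ⊢
        rw [iterate_map_add, ha, hb, add_zero]
      zero_mem' := iterate_map_zero θ e
      smul_mem' := fun s z hz => by
        rw [Set.mem_ofPred_eq] at hz ⊢
        rw [iterate_smul_of_semilinear θ hθ, hz, smul_zero] }
  have hK : ∀ e z, z ∈ K e ↔ θ^[e] z = 0 := fun e z => Iff.rfl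
  have hKθ : ∀ e z, z ∈ K (e + 1) ↔ θ z ∈ K e := fun e z => by
    rw [hK, hK, Function.iterate_succ_apply]
  have hKmono : Monotone K := monotone_nat_of_le_succ fun e z hz => by
    rw [hK] at hz ⊢
    rw [Function.iterate_succ_apply', hz, map_zero]
  let b : ℕ →o Ideal S := ⟨fun e => (K e).colon (K (e + 1) : Set E),
    monotone_nat_of_le_succ fun e s hs => by
      rw [Submodule.mem_colon] at hs ⊢
      intro z hz
      rw [SetLike.mem_coe, hKθ] at hz
      rw [hKθ, hθ, show s ^ q = s ^ (q - 1) * s by rw [← pow_succ]; congr 1; omega, mul_smul]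
      exact (K e).smul_mem _ (hs _ hz)⟩
  obtain ⟨e₁, he₁⟩ := monotone_stabilizes_iff_noetherian.2 (inferInstance : IsNoetherian S S) b
  have hb : ∀ e ≥ e₁, ∀ s, s ∈ b e₁ ↔ ∀ z ∈ K (e + 1), s • z ∈ K e := fun e he s => by
    rw [he₁ e he]
    exact Submodule.mem_colon
  refine ⟨e₁, fun n z hz => ?_⟩
  by_cases htop : b e₁ = ⊤
  · have hle : ∀ k, K (e₁ + k) ≤ K e₁ := by
      intro k
      induction k with
      | zero => exact le_rfl
      | succ k ih =>
        intro w hw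
        refine ih ?_
        have := (hb (e₁ + k) (Nat.le_add_right _ _) 1).1 (htop ▸ Submodule.mem_top) w hw
        rwa [one_smul] at this
    exact hle n (hKmono (Nat.le_add_left n e₁) hz)
  exfalso
  -- as `q ≥ 2`, a factor in `b` before `θ` becomes one in `b ^ 2` after it
  have hsq : ∀ k, ∀ w ∈ K (e₁ + k), ∀ x ∈ b e₁, ∀ x' ∈ b e₁, x' • x • w ∈ K e₁ := by
    intro k
    induction k with
    | zero => exact fun w hw x _ x' _ => (K e₁).smul_mem _ ((K e₁).smul_mem _ hw)
    | succ k ih =>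
      intro w hw x hx x' hx'
      refine (hb e₁ le_rfl x').1 hx' _ ?_
      rw [hKθ, hθ, show x ^ q = x ^ (q - 2) * (x * x) by
        rw [← pow_two, ← pow_add]; congr 1; omega, mul_smul, mul_smul]
      exact (K e₁).smul_mem _ (ih _ ((hKθ _ _).1 hw) x hx x hx)
  obtain ⟨P, hP⟩ := Ideal.nonempty_minimalPrimes htop
  have hPprime : P.IsPrime := hP.isPrime
  let A : ℕ → Ideal S := fun k => (K (e₁ + k)).annihilator
  have hA : Antitone A := fun k l h => Submodule.annihilator_mono (hKmono (by omega))
  have hbA : ∀ k, b e₁ ^ 2 * A 0 ≤ A k := by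
    intro k
    rw [pow_two, Ideal.mul_le]
    intro r hr a ha
    refine Submodule.mul_induction_on hr (fun x hx x' hx' => ?_) fun r r' h h' => by
      rw [add_mul]; exact Ideal.add_mem _ h h'
    rw [Submodule.mem_annihilator]
    intro w hw
    rw [mul_comm, mul_smul, mul_smul]
    exact Submodule.mem_annihilator.1 ha _ (hsq k w hw x' hx' x hx)
  let L := Localization.AtPrime P
  obtain ⟨k, hk⟩ := exists_eq_succ_of_mul_le ((b e₁ ^ 2).map (algebraMap S L)) (by
      rw [IsLocalization.minimalPrimes_map P.primeCompl, Set.mem_preimage,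
        Localization.AtPrime.under_maximalIdeal, ← Ideal.radical_minimalPrimes,
        Ideal.radical_pow _ two_ne_zero, Ideal.radical_minimalPrimes]
      exact hP)
    (fun k => (A k).map (algebraMap S L)) (fun k l h => Ideal.map_mono (hA h))
    (fun k => by rw [← Ideal.map_mul]; exact Ideal.map_mono (hbA k))
  -- clear denominators in the equality of localizations
  obtain ⟨s, hsP, hs⟩ : ∃ s ∉ P, ∀ a ∈ A k, s * a ∈ A (k + 1) := by
    obtain ⟨T, hT⟩ := IsNoetherian.noetherian (A k)
    have h1 : ∀ a ∈ T, ∃ s ∉ P, s * a ∈ A (k + 1) := by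
      intro a ha
      have h2 : algebraMap S L a ∈ (A (k + 1)).map (algebraMap S L) := by
        rw [hk]
        exact Ideal.mem_map_of_mem _ (hT ▸ Submodule.subset_span ha)
      obtain ⟨m, hm, hma⟩ :=
        (IsLocalization.algebraMap_mem_map_algebraMap_iff P.primeCompl L _ _).1 h2
      exact ⟨m, hm, hma⟩
    choose! g hg hgA using h1
    refine ⟨∏ a ∈ T, g a, fun h => ?_, fun a ha => ?_⟩
    · obtain ⟨a, ha, haP⟩ := hPprime.prod_mem_iff.1 h
      exact hg a ha haP
    · have h3 : A k ≤ (A (k + 1)).colon {∏ a ∈ T, g a} := by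
        rw [← hT, Submodule.span_le]
        intro a ha
        rw [SetLike.mem_coe, Submodule.mem_colon_singleton, smul_eq_mul, mul_comm,
          ← Finset.mul_prod_erase T g ha, mul_right_comm]
        exact Ideal.mul_mem_right _ _ (hgA a ha)
      have h4 := Submodule.mem_colon_singleton.1 (h3 ha)
      rwa [smul_eq_mul, mul_comm] at h4
  refine hsP (hP.1.2 ((hb (e₁ + k) (Nat.le_add_right _ _) s).2 fun w hw => ?_))
  by_contra hsw
  obtain ⟨a, ha, haw⟩ := hdual _ _ hsw
  refine haw ?_
  rw [← mul_smul, mul_comm]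
  exact Submodule.mem_annihilator.1 (hs a (Submodule.mem_annihilator.2 ha)) w hw

end FrobeniusAction

/-! ### Sequences whose shifts have no lexicographically descending chain -/

section Sequences

variable {A : Type*}

/-- The sequence `a` with its first `j` terms removed. -/
def shiftSeq (j : ℕ) (a : ℕ → A) : ℕ → A := fun i => a (j + i)

theorem mem_closure_iff_agree [TopologicalSpace A] [DiscreteTopology A] {s : Set (ℕ → A)}
    {x : ℕ → A} : x ∈ closure s ↔ ∀ n, ∃ y ∈ s, ∀ i < n, y i = x i := by
  rw [(PiNat.isTopologicalBasis_cylinders fun _ : ℕ => A).mem_closure_iff]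
  constructor
  · intro h n
    obtain ⟨y, hy, hys⟩ := h _ ⟨x, n, rfl⟩ (PiNat.self_mem_cylinder x n)
    exact ⟨y, hys, PiNat.mem_cylinder_iff.1 hy⟩
  · rintro h _ ⟨z, n, rfl⟩ hx
    obtain ⟨y, hys, hy⟩ := h n
    exact ⟨y, PiNat.mem_cylinder_iff.2 fun i hi =>
      (hy i hi).trans (PiNat.mem_cylinder_iff.1 hx i hi), hys⟩

theorem continuous_shiftSeq [TopologicalSpace A] (j : ℕ) :
    Continuous (shiftSeq j : (ℕ → A) → ℕ → A) :=
  continuous_pi fun i => continuous_apply (j + i)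

theorem shiftSeq_shiftSeq (i j : ℕ) (a : ℕ → A) :
    shiftSeq i (shiftSeq j a) = shiftSeq (j + i) a := by
  funext k
  simp [shiftSeq, add_assoc]

variable [LinearOrder A]

/-- The strict lexicographic order on sequences. -/
def LexLT (a b : ℕ → A) : Prop := ∃ n, (∀ i < n, a i = b i) ∧ a n < b n

theorem lexLT_or_lexLT_of_ne {a b : ℕ → A} (h : a ≠ b) : LexLT a b ∨ LexLT b a := by
  classical
  have hex : ∃ n, a n ≠ b n := Function.ne_iff.1 h
  have hlt : ∀ i < Nat.find hex, a i = b i := fun i hi => not_not.1 (Nat.find_min hex hi)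
  rcases lt_or_gt_of_ne (Nat.find_spec hex) with h1 | h1
  · exact Or.inl ⟨_, hlt, h1⟩
  · exact Or.inr ⟨_, fun i hi => (hlt i hi).symm, h1⟩

/-- If the shifts of `d` contain no infinite lexicographically descending chain, then neither does
their closure; hence every nonempty part `Q` of the closure has a least element. -/
theorem exists_forall_not_lexLT [TopologicalSpace A] [DiscreteTopology A] {d : ℕ → A}
    (hd : ¬ ∃ g : ℕ → ℕ, ∀ i, LexLT (shiftSeq (g (i + 1)) d) (shiftSeq (g i) d))
    {Q : (ℕ → A) → Prop} (hQ : ∀ x, Q x → x ∈ closure (Set.range fun j => shiftSeq j d))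
    {x₀ : ℕ → A} (h₀ : Q x₀) : ∃ x, Q x ∧ ∀ x', Q x' → ¬ LexLT x' x := by
  by_contra! hstep
  choose! next hnextQ hnext using hstep
  let g : ℕ → ℕ → A := fun i => next^[i] x₀
  have hgs : ∀ i, g (i + 1) = next (g i) := fun i => Function.iterate_succ_apply' _ _ _
  have hgQ : ∀ i, Q (g i) := fun i => by
    induction i with
    | zero => exact h₀
    | succ i ih => rw [hgs]; exact hnextQ _ ih
  have hg : ∀ i, LexLT (g (i + 1)) (g i) := fun i => by rw [hgs]; exact hnext _ (hgQ i)
  choose n hn hlt using hg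
  -- approximate each term beyond its first differences with both neighbours
  have happ : ∀ i, ∃ j, ∀ k < n i + n (i - 1) + 1, shiftSeq j d k = g i k := fun i => by
    obtain ⟨_, ⟨j, rfl⟩, hj⟩ := mem_closure_iff_agree.1 (hQ _ (hgQ i)) (n i + n (i - 1) + 1)
    exact ⟨j, hj⟩
  choose j hj using happ
  refine hd ⟨j, fun i => ⟨n i, fun k hk => ?_, ?_⟩⟩
  · rw [hj i k (by omega), hj (i + 1) k (by rw [Nat.add_sub_cancel]; omega), hn i k hk]
  · rw [hj i _ (by omega), hj (i + 1) _ (by rw [Nat.add_sub_cancel]; omega)]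
    exact hlt i

/-- Let `d` be a sequence in a finite linear order whose shifts contain no infinite
lexicographically descending chain. Then `d` is eventually periodic or its shifts approach a
periodic sequence from below.

A minimal shift-invariant closed subset of the closure of the shifts has a least element, which is
isolated in it and hence periodic. -/
theorem eventually_periodic_or_exists_periodic_limit [Finite A] {d : ℕ → A}
    (hd : ¬ ∃ g : ℕ → ℕ, ∀ i, LexLT (shiftSeq (g (i + 1)) d) (shiftSeq (g i) d)) :
    (∃ j b, 0 < b ∧ ∀ i ≥ j, d (i + b) = d i) ∨
    ∃ (w : ℕ → A) (b : ℕ), 0 < b ∧ (∀ i, w (i + b) = w i) ∧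
      ∀ n, ∃ j, LexLT (shiftSeq j d) w ∧ ∀ i < n, shiftSeq j d i = w i := by
  classical
  let : TopologicalSpace A := ⊥
  have : DiscreteTopology A := ⟨rfl⟩
  set X : Set (ℕ → A) := closure (Set.range fun j => shiftSeq j d) with hX
  have hXinv : ∀ x ∈ X, shiftSeq 1 x ∈ X := fun x hx =>
    map_mem_closure (continuous_shiftSeq 1) hx (by
      rintro _ ⟨j, rfl⟩
      exact ⟨j + 1, (shiftSeq_shiftSeq 1 j d).symm⟩)
  -- a minimal nonempty closed invariant subset
  obtain ⟨Y, ⟨hYc, ⟨x₀, hx₀⟩, hYX, hYinv⟩, hYmin⟩ := zorn_superset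
    {Y : Set (ℕ → A) | IsClosed Y ∧ Y.Nonempty ∧ Y ⊆ X ∧ ∀ x ∈ Y, shiftSeq 1 x ∈ Y} (by
      intro c hc hchain
      rcases c.eq_empty_or_nonempty with rfl | hne
      · exact ⟨X, ⟨isClosed_closure, ⟨_, subset_closure ⟨0, rfl⟩⟩, subset_rfl, hXinv⟩, by simp⟩
      · refine ⟨⋂₀ c, ⟨isClosed_sInter fun s hs => (hc hs).1, ?_, ?_, ?_⟩, fun s hs =>
          Set.sInter_subset_of_mem hs⟩
        · have := hne.to_subtype
          refine IsCompact.nonempty_sInter_of_directed_nonempty_isCompact_isClosed ?_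
            (fun s hs => (hc hs).2.1) (fun s hs => (hc hs).1.isCompact) (fun s hs => (hc hs).1)
          intro s hs t ht
          rcases hchain.total hs ht with h | h
          · exact ⟨s, hs, subset_rfl, h⟩
          · exact ⟨t, ht, h, subset_rfl⟩
        · obtain ⟨s, hs⟩ := hne
          exact (Set.sInter_subset_of_mem hs).trans (hc hs).2.2.1
        · exact fun x hx s hs => (hc hs).2.2.2 x (hx s hs))
  obtain ⟨y₀, hy₀, hleast⟩ := exists_forall_not_lexLT hd (Q := (· ∈ Y)) (fun x hx => hYX hx) hx₀
  -- `y₀` is isolated in `Y`: otherwise the elements of `Y` above it would have no least one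
  have hiso : ∃ n, ∀ z ∈ Y, (∀ i < n, z i = y₀ i) → z = y₀ := by
    by_contra! hcon
    have hcon' : ∀ n, ∃ z ∈ Y, (∀ i < n, z i = y₀ i) ∧ LexLT y₀ z := fun n => by
      obtain ⟨z, hz, hagree, hne⟩ := hcon n
      exact ⟨z, hz, hagree, (lexLT_or_lexLT_of_ne hne).resolve_left (hleast z hz)⟩
    obtain ⟨z₀, hz₀, -, hlt₀⟩ := hcon' 0
    obtain ⟨z, ⟨hzY, n, hn, hlt⟩, hz⟩ := exists_forall_not_lexLT hd
      (Q := fun z => z ∈ Y ∧ LexLT y₀ z) (fun x hx => hYX hx.1) ⟨hz₀, hlt₀⟩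
    obtain ⟨z', hz', hagree, hlt'⟩ := hcon' (n + 1)
    refine hz z' ⟨hz', hlt'⟩ ⟨n, fun i hi => ?_, ?_⟩
    · rw [hagree i (by omega), hn i hi]
    · rw [hagree n (by omega)]; exact hlt
  have hshift : ∀ k, shiftSeq k y₀ ∈ Y := fun k => by
    induction k with
    | zero =>
      have : shiftSeq 0 y₀ = y₀ := by funext i; simp [shiftSeq]
      rwa [this]
    | succ k ih => rw [← shiftSeq_shiftSeq]; exact hYinv _ ih
  -- by minimality `y₀` is a limit of its own proper shifts, hence equal to one of them
  obtain ⟨b, hb, hper⟩ : ∃ b, 0 < b ∧ shiftSeq b y₀ = y₀ := by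
    set O : Set (ℕ → A) := closure (Set.range fun k => shiftSeq (k + 1) y₀) with hO
    have hOY : O ⊆ Y := closure_minimal (by rintro _ ⟨k, rfl⟩; exact hshift _) hYc
    have hYO : Y ⊆ O := hYmin ⟨isClosed_closure, ⟨_, subset_closure ⟨0, rfl⟩⟩, hOY.trans hYX,
      fun x hx => map_mem_closure (continuous_shiftSeq 1) hx (by
        rintro _ ⟨k, rfl⟩
        exact ⟨k + 1, (shiftSeq_shiftSeq 1 (k + 1) y₀).symm⟩)⟩ hOY
    obtain ⟨n, hn⟩ := hiso
    obtain ⟨_, ⟨k, rfl⟩, hk⟩ := mem_closure_iff_agree.1 (hYO hy₀) n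
    exact ⟨k + 1, Nat.succ_pos k, hn _ (hshift _) hk⟩
  have hper' : ∀ i, y₀ (i + b) = y₀ i := fun i => by
    conv_rhs => rw [← hper]
    rw [shiftSeq, add_comm]
  by_cases hmem : ∃ j, shiftSeq j d = y₀
  · obtain ⟨j, hj⟩ := hmem
    refine Or.inl ⟨j, b, hb, fun i hi => ?_⟩
    obtain ⟨k, rfl⟩ := Nat.exists_eq_add_of_le hi
    have := hper' k
    rw [← hj, shiftSeq, shiftSeq, ← add_assoc] at this
    exact this
  · right
    push Not at hmem
    refine ⟨y₀, b, hb, hper', ?_⟩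
    by_contra! hcon
    obtain ⟨n, hn⟩ := hcon
    have happ : ∀ m, ∃ j, ∀ i < m, shiftSeq j d i = y₀ i := fun m => by
      obtain ⟨_, ⟨j, rfl⟩, hj⟩ := mem_closure_iff_agree.1 (hYX hy₀) m
      exact ⟨j, hj⟩
    have hgt : ∀ j, (∀ i < n, shiftSeq j d i = y₀ i) → LexLT y₀ (shiftSeq j d) := fun j hj =>
      (lexLT_or_lexLT_of_ne (hmem j)).resolve_left fun hlt => by
        obtain ⟨i, hi, hne⟩ := hn j hlt
        exact hne (hj i hi)
    obtain ⟨j₀, hj₀⟩ := happ n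
    obtain ⟨_, ⟨j, rfl, hj⟩, hmin⟩ := exists_forall_not_lexLT hd
      (Q := fun x => ∃ j, x = shiftSeq j d ∧ ∀ i < n, shiftSeq j d i = y₀ i)
      (by rintro _ ⟨j, rfl, -⟩; exact subset_closure ⟨j, rfl⟩) ⟨j₀, rfl, hj₀⟩
    obtain ⟨m, hm, hlt⟩ := hgt j hj
    obtain ⟨j', hj'⟩ := happ (max n (m + 1))
    refine hmin _ ⟨j', rfl, fun i hi => hj' i (by omega)⟩ ⟨m, fun i hi => ?_, ?_⟩
    · rw [hj' i (by omega), hm i hi]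
    · rw [hj' m (by omega)]; exact hlt

end Sequences

/-! ### Digit sequences acting through Frobenius -/

section Digits

variable {S E : Type*} [CommRing S] [AddCommGroup E] [Module S E]

/-- The composite `f ^ w (e - 1) F ∘ ⋯ ∘ f ^ w 0 F`. -/
def wordAction (F : E →+ E) (f : S) (w : ℕ → ℕ) : ℕ → E → E
  | 0, z => z
  | e + 1, z => f ^ w e • F (wordAction F f w e z)

/-- The integer with base-`p` digits `w 0, …, w (e - 1)`, most significant digit first. -/
def wordValue (p : ℕ) (w : ℕ → ℕ) : ℕ → ℕ
  | 0 => 0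
  | e + 1 => p * wordValue p w e + w e

variable {F : E →+ E} {p : ℕ}

theorem wordAction_eq_smul (hF : ∀ (s : S) z, F (s • z) = s ^ p • F z) (f : S) (w : ℕ → ℕ) (e : ℕ)
    (z : E) : wordAction F f w e z = f ^ wordValue p w e • F^[e] z := by
  induction e with
  | zero => simp [wordAction, wordValue]
  | succ e ih =>
    rw [wordAction, ih, hF, Function.iterate_succ_apply', ← mul_smul, ← pow_mul, ← pow_add,
      wordValue]
    congr 2
    ring

theorem wordAction_congr (f : S) {w w' : ℕ → ℕ} {e : ℕ} (h : ∀ i < e, w i = w' i) (z : E) :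
    wordAction F f w e z = wordAction F f w' e z := by
  induction e with
  | zero => rfl
  | succ e ih =>
    rw [wordAction, wordAction, ih fun i hi => h i (by omega), h e (Nat.lt_succ_self e)]

theorem wordAction_add (f : S) (w : ℕ → ℕ) (e e' : ℕ) (z : E) :
    wordAction F f w (e + e') z =
      wordAction F f (fun i => w (e + i)) e' (wordAction F f w e z) := by
  induction e' with
  | zero => rfl
  | succ e' ih => rw [← add_assoc, wordAction, wordAction, ih]

theorem wordAction_eq_zero_of_le {f : S} {w : ℕ → ℕ} {e e' : ℕ} {z : E}
    (h : wordAction F f w e z = 0) (he : e ≤ e') : wordAction F f w e' z = 0 := by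
  induction e', he using Nat.le_induction with
  | base => exact h
  | succ e' _ ih => rw [wordAction, ih, map_zero, smul_zero]

theorem wordValue_congr {w w' : ℕ → ℕ} {e : ℕ} (h : ∀ i < e, w i = w' i) :
    wordValue p w e = wordValue p w' e := by
  induction e with
  | zero => rfl
  | succ e ih => rw [wordValue, wordValue, ih fun i hi => h i (by omega), h e (Nat.lt_succ_self e)]

/-- Lexicographic comparison of digit sequences bounds the integers formed by their initial
segments. Only the digits of the smaller sequence need to be less than `p`. -/
theorem wordValue_le_of_lexLT {w w' : ℕ → ℕ} (hw : ∀ i, w i < p) (h : LexLT w w') (e : ℕ) :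
    wordValue p w e ≤ wordValue p w' e := by
  obtain ⟨n, hn, hlt⟩ := h
  have hsucc : ∀ k, wordValue p w (n + 1 + k) + 1 ≤ wordValue p w' (n + 1 + k) := by
    intro k
    induction k with
    | zero =>
      rw [add_zero, wordValue, wordValue, wordValue_congr hn]
      omega
    | succ k ih =>
      rw [← add_assoc, wordValue, wordValue]
      have h1 := Nat.mul_le_mul_left p ih
      have h2 := hw (n + 1 + k)
      rw [mul_add, mul_one] at h1
      omega
  rcases Nat.lt_or_ge n e with h1 | h1
  · obtain ⟨k, rfl⟩ := Nat.exists_eq_add_of_le (Nat.succ_le_of_lt h1)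
    exact (Nat.le_succ _).trans (hsucc k)
  · exact (wordValue_congr fun i hi => hn i (by omega)).le

/-- The elements of `E` killed by the composites along an initial segment of the word `w`. -/
def wordKernel (hF : ∀ (s : S) z, F (s • z) = s ^ p • F z) (f : S) (w : ℕ → ℕ) :
    Submodule S E where
  carrier := {z | ∃ e, wordAction F f w e z = 0}
  add_mem' := by
    rintro a b ⟨e, ha⟩ ⟨e', hb⟩
    have ha' := wordAction_eq_zero_of_le ha (Nat.le_add_right e e')
    have hb' := wordAction_eq_zero_of_le hb (Nat.le_add_left e' e)
    refine ⟨e + e', ?_⟩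
    rw [wordAction_eq_smul hF] at ha' hb' ⊢
    rw [iterate_map_add, smul_add, ha', hb', add_zero]
  zero_mem' := ⟨0, rfl⟩
  smul_mem' := by
    rintro s a ⟨e, ha⟩
    refine ⟨e, ?_⟩
    rw [wordAction_eq_smul hF] at ha ⊢
    rw [iterate_smul_of_semilinear F hF, smul_comm, ha, smul_zero]

theorem smul_ne_zero_of_le {f : S} {k l : ℕ} (h : k ≤ l) {z : E} (hl : f ^ l • z ≠ 0) :
    f ^ k • z ≠ 0 := fun hk => hl (by
  obtain ⟨m, rfl⟩ := Nat.exists_eq_add_of_le h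
  rw [add_comm, pow_add, mul_smul, hk, smul_zero])

theorem wordKernel_mono {hF : ∀ (s : S) z, F (s • z) = s ^ p • F z} (f : S) {w w' : ℕ → ℕ}
    (hw : ∀ i, w i < p) (h : LexLT w w') : wordKernel hF f w ≤ wordKernel hF f w' := by
  rintro z ⟨e, he⟩
  refine ⟨e, ?_⟩
  rw [wordAction_eq_smul hF] at he ⊢
  by_contra hne
  exact smul_ne_zero_of_le (wordValue_le_of_lexLT hw h e) hne he

/-- For `z` killed by `f`, the word `D` records greedily the exponents with
`f ^ D e • F (z e) ≠ 0` along the sequence `z (e + 1) = f ^ D e • F (z e)`. -/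
theorem exists_greedy_word (hF : ∀ (s : S) z, F (s • z) = s ^ p • F z)
    (hinj : Function.Injective F) (hp : 0 < p) {f : S} {z : E} (hz : z ≠ 0) (hfz : f • z = 0) :
    ∃ D : ℕ → Fin p, ∀ e, wordAction F f (fun i => D i) e z ≠ 0 ∧
      f • wordAction F f (fun i => D i) e z = 0 := by
  classical
  have hstep : ∀ u : {u : E // u ≠ 0 ∧ f • u = 0}, ∃ k : Fin p,
      f ^ (k : ℕ) • F u ≠ 0 ∧ f • f ^ (k : ℕ) • F u = 0 := by
    rintro ⟨u, hu, hfu⟩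
    have hex : ∃ k, f ^ k • F u = 0 := ⟨p, by rw [← hF, hfu, map_zero]⟩
    have hpos : Nat.find hex ≠ 0 := fun h => by
      have := Nat.find_spec hex
      rw [h, pow_zero, one_smul] at this
      exact hu (hinj (by rw [this, map_zero]))
    have hle : Nat.find hex ≤ p := Nat.find_min' hex (by rw [← hF, hfu, map_zero])
    refine ⟨⟨Nat.find hex - 1, by omega⟩, Nat.find_min hex (by dsimp only; omega), ?_⟩
    rw [← mul_smul, ← pow_succ', Nat.sub_add_cancel (Nat.one_le_iff_ne_zero.2 hpos)]
    exact Nat.find_spec hex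
  choose k hk hk0 using hstep
  let η : ℕ → {u : E // u ≠ 0 ∧ f • u = 0} := fun n =>
    (fun u => ⟨f ^ (k u : ℕ) • F u, hk u, hk0 u⟩)^[n] ⟨z, hz, hfz⟩
  have hη : ∀ e, wordAction F f (fun i => k (η i)) e z = η e := fun e => by
    induction e with
    | zero => rfl
    | succ e ih =>
      rw [wordAction, ih]
      simp only [η, Function.iterate_succ_apply']
  exact ⟨fun e => k (η e), fun e => by rw [hη]; exact (η e).2⟩

/-- The greedy word is eventually periodic: the kernels attached to its shifts decrease strictly
with the shifts, so an Artinian `E` leaves no descending chain of shifts, and a periodic limit from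
below would contradict the bounded nilpotency of the Frobenius action of its period. -/
theorem greedy_word_eventually_periodic [IsNoetherianRing S]
    (hdual : ∀ (N : Submodule S E) (z : E), z ∉ N → ∃ s : S, (∀ n ∈ N, s • n = 0) ∧ s • z ≠ 0)
    (hF : ∀ (s : S) z, F (s • z) = s ^ p • F z) (hp : 2 ≤ p) {f : S} {z : E}
    {D : ℕ → Fin p} (hD : ∀ e, wordAction F f (fun i => D i) e z ≠ 0 ∧
      f • wordAction F f (fun i => D i) e z = 0) :
    ∃ j b, 0 < b ∧ ∀ i ≥ j, D (i + b) = D i := by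
  let v : (ℕ → Fin p) → ℕ → ℕ := fun w i => w i
  have hvlex : ∀ {w w' : ℕ → Fin p}, LexLT w w' → LexLT (v w) (v w') := fun ⟨n, hn, hlt⟩ =>
    ⟨n, fun i hi => congrArg Fin.val (hn i hi), hlt⟩
  let η : ℕ → E := fun j => wordAction F f (v D) j z
  have hη0 : ∀ j, η j ≠ 0 := fun j => (hD j).1
  have hfη : ∀ j, f • η j = 0 := fun j => (hD j).2
  have hη : ∀ j e, wordAction F f (v (shiftSeq j D)) e (η j) = η (j + e) := fun j e =>
    (wordAction_add f (v D) j e z).symm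
  have hagree : ∀ {j n} {w : ℕ → Fin p}, (∀ i < n, shiftSeq j D i = w i) →
      wordAction F f (v w) n (η j) = η (j + n) := fun h => by
    rw [← hη, wordAction_congr f fun i hi => (congrArg Fin.val (h i hi)).symm]
  -- where `w` first exceeds the shift, `w` asks for at least one more factor `f`, and `f • η = 0`
  have hbig : ∀ {j} {w : ℕ → Fin p}, LexLT (shiftSeq j D) w → η j ∈ wordKernel hF f (v w) := by
    rintro j w ⟨n, hn, hlt⟩
    refine ⟨n + 1, ?_⟩
    rw [wordAction, hagree hn]
    by_contra hne
    have h1 : f ^ (D (j + n) + 1 : ℕ) • F (η (j + n)) ≠ 0 :=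
      smul_ne_zero_of_le (Nat.succ_le_of_lt hlt) hne
    refine h1 ?_
    rw [pow_succ', mul_smul]
    exact hfη (j + n + 1)
  have hnot : ∀ j, η j ∉ wordKernel hF f (v (shiftSeq j D)) := by
    rintro j ⟨e, he⟩
    rw [hη] at he
    exact hη0 _ he
  have hart := isArtinian_of_forall_exists_smul_ne_zero hdual
  have hchain : ¬ ∃ g : ℕ → ℕ, ∀ i, LexLT (shiftSeq (g (i + 1)) D) (shiftSeq (g i) D) := by
    rintro ⟨g, hg⟩
    obtain ⟨_, ⟨i, rfl⟩, hmin⟩ := IsArtinian.set_has_minimal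
      (Set.range fun i => wordKernel hF f (v (shiftSeq (g i) D))) ⟨_, 0, rfl⟩
    refine hmin _ ⟨i + 1, rfl⟩ (lt_of_le_of_ne
      (wordKernel_mono f (fun i => (shiftSeq _ D i).2) (hvlex (hg i))) fun h => ?_)
    have h' : wordKernel hF f (v (shiftSeq (g (i + 1)) D)) =
      wordKernel hF f (v (shiftSeq (g i) D)) := h
    exact hnot (g (i + 1)) (h' ▸ hbig (hg i))
  refine (eventually_periodic_or_exists_periodic_limit hchain).resolve_right ?_
  rintro ⟨w, b, hb, hper, hlim⟩
  -- the Frobenius action of one period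
  let θ : E →+ E :=
    { toFun := wordAction F f (v w) b
      map_zero' := by rw [wordAction_eq_smul hF, iterate_map_zero, smul_zero]
      map_add' := fun x y => by
        simp only [wordAction_eq_smul hF, iterate_map_add, smul_add] }
  have hθ : ∀ (s : S) u, θ (s • u) = s ^ p ^ b • θ u := fun s u => by
    change wordAction F f (v w) b (s • u) = _ • wordAction F f (v w) b u
    rw [wordAction_eq_smul hF, wordAction_eq_smul hF, iterate_smul_of_semilinear F hF, smul_comm]
  have hiter : ∀ n u, θ^[n] u = wordAction F f (v w) (b * n) u := fun n u => by
    induction n with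
    | zero => rfl
    | succ n ih =>
      have hper' : ∀ i, w (b * n + i) = w i := fun i => by
        clear ih
        induction n with
        | zero => simp
        | succ n ihn => rw [← ihn, ← hper (b * n + i)]; congr 1; ring
      rw [Function.iterate_succ_apply', ih, mul_add, mul_one, wordAction_add]
      exact wordAction_congr f (fun i _ => (congrArg Fin.val (hper' i)).symm) _
  have hq : 2 ≤ p ^ b := hp.trans (Nat.le_self_pow hb.ne' p)
  obtain ⟨e, he⟩ := exists_iterate_eq_zero_of_semilinear hdual θ hq hθ
  obtain ⟨j, hlt, hj⟩ := hlim (b * e)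
  obtain ⟨m, hm⟩ := hbig hlt
  have h1 := he m (η j) (by
    rw [hiter]
    exact wordAction_eq_zero_of_le hm (Nat.le_mul_of_pos_left m hb))
  rw [hiter, hagree hj] at h1
  exact hη0 _ h1

end Digits

/-! ### Periodicity of the digits of the threshold -/

/-- Minimal generators of the maximal ideal of a regular local ring form a regular sequence in any
order. -/
theorem IsRegularLocalRing.exists_isPermRegular (R : Type*) [CommRing R] [IsRegularLocalRing R] :
    ∃ s : Finset R, Ideal.span (Set.range ((↑) : s → R)) = maximalIdeal R ∧
      IsPermRegular ((↑) : s → R) := by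
  classical
  have hfg : Submodule.FG (maximalIdeal R) := IsNoetherian.noetherian _
  have hfin := hfg.finite_generators
  let s := hfin.toFinset
  have hs : Ideal.span (s : Set R) = maximalIdeal R := by
    rw [hfin.coe_toFinset]
    exact Submodule.span_generators _
  have hcard : (s.card : WithBot ℕ∞) ≤ ringKrullDim R := by
    rw [← Set.ncard_eq_toFinset_card _ hfin, hfg.generators_ncard,
      IsRegularLocalRing.spanFinrank_maximalIdeal]
  refine ⟨s, by rw [Subtype.range_coe_subtype]; exact hs, fun T j hj r hr => ?_⟩
  have himage : ((↑) : s → R) '' (T : Set s) = ((T.image (↑) : Finset R) : Set R) := by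
    rw [Finset.coe_image]
  rw [himage] at hr ⊢
  refine mem_span_of_mul_mem_span s hs hcard (fun a ha => ?_) j.2 (fun h => ?_) hr
  · obtain ⟨b, -, rfl⟩ := Finset.mem_image.1 ha
    exact b.2
  · obtain ⟨b, hb, hbj⟩ := Finset.mem_image.1 h
    exact hj (Subtype.ext hbj ▸ hb)

namespace FPureThreshold

theorem mu_eq_succ_of_forall {R : Type*} [CommRing R] [IsLocalRing R] {f : R} {q k : ℕ}
    (h1 : f ^ k ∉ bracketPower (maximalIdeal R) q)
    (h2 : f ^ (k + 1) ∈ bracketPower (maximalIdeal R) q) : mu f q = k + 1 := by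
  refine le_antisymm (Nat.sInf_le h2) (le_csInf ⟨_, h2⟩ fun l hl => ?_)
  by_contra hlt
  exact h1 (Ideal.mem_of_dvd _ (pow_dvd_pow f (by omega)) hl)

/-- The base-`p` digits of the `F`-pure threshold of `f` are eventually periodic, and `μ_f(p ^ e)`
is one more than the integer formed by the first `e` of them. -/
theorem exists_periodic_digits {R : Type*} [CommRing R] [IsRegularLocalRing R] (p : ℕ)
    [hp : Fact p.Prime] [CharP R p] (f : R) (hf : f ∈ maximalIdeal R) :
    ∃ D : ℕ → ℕ, (∀ i, D i < p) ∧ (∃ j b, 0 < b ∧ ∀ i ≥ j, D (i + b) = D i) ∧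
      ∀ e, mu f (p ^ e) = wordValue p D e + 1 := by
  classical
  obtain ⟨s, hm, hx⟩ := IsRegularLocalRing.exists_isPermRegular R
  set x : s → R := (↑) with hxdef
  have hcharP : CharP (Localization.Away (∏ i, x i)) p :=
    charP_of_injective_algebraMap hx.algebraMap_injective p
  have H := hx.isInverseSystem hm
  let F : TopLocalCohomology x →+ TopLocalCohomology x := (cechFrobenius p x).toAddMonoidHom
  have hFR : ∀ (r : R) z, F (r • z) = r ^ p • F z := fun r z =>
    (cechFrobenius p x).map_smulₛₗ r z
  have hFy : ∀ e, F^[e] (cechClass x 1) = cechClass x (p ^ e) := fun e => by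
    induction e with
    | zero => rfl
    | succ e ih =>
      rw [Function.iterate_succ_apply', ih, pow_succ]
      exact cechFrobenius_cechClass p x _
  have hFinj : Function.Injective F := H.semilinear_injective F hFR fun h => by
    have h1 : (1 : R) ∈ unifPowIdeal x p := by
      rw [← hx.smul_cechClass_eq_zero_iff, one_smul]
      have := hFy 1
      rw [pow_one] at this
      rw [← this]
      exact h
    exact (Ideal.ne_top_iff_one _).1 (IsLocalRing.maximalIdeal.isMaximal R).ne_top
      (Ideal.pow_le_self hp.out.ne_zero (H.le_pow p h1))
  let _ : CommRing (Module.End R (TopLocalCohomology x)) := H.endCommRing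
  have hnoeth : IsNoetherianRing (Module.End R (TopLocalCohomology x)) := H.isNoetherianRing_end
  have hF : ∀ (φ : Module.End R (TopLocalCohomology x)) z, F (φ • z) = φ ^ p • F z :=
    H.semilinear_end_apply F hFR
  have hdual : ∀ (N : Submodule (Module.End R (TopLocalCohomology x)) (TopLocalCohomology x))
      (z : TopLocalCohomology x), z ∉ N →
      ∃ φ : Module.End R (TopLocalCohomology x), (∀ n ∈ N, φ • n = 0) ∧ φ • z ≠ 0 :=
    fun N z hz => H.exists_end_apply_ne_zero (N.restrictScalars R) hz
  have hpow : ∀ (k : ℕ) (z : TopLocalCohomology x),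
      (algebraMap R (Module.End R (TopLocalCohomology x)) f) ^ k • z = f ^ k • z := fun k z => by
    rw [← map_pow]
    rfl
  have hker : ∀ k e, (algebraMap R (Module.End R (TopLocalCohomology x)) f) ^ k •
      F^[e] (cechClass x 1) = 0 ↔ f ^ k ∈ bracketPower (maximalIdeal R) (p ^ e) := fun k e => by
    rw [hpow, hFy, hx.smul_cechClass_eq_zero_iff, bracketPower_maximalIdeal p hm]
  obtain ⟨D, hD⟩ := exists_greedy_word hF hFinj hp.out.pos (z := cechClass x 1)
    (f := algebraMap R (Module.End R (TopLocalCohomology x)) f) H.class_one_ne_zero (by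
      have := hker 1 0
      rw [pow_one, pow_one, Function.iterate_zero_apply, pow_zero] at this
      exact this.2 (Ideal.subset_span ⟨f, hf, pow_one f⟩))
  obtain ⟨j, b, hb, hper⟩ := greedy_word_eventually_periodic hdual hF hp.out.two_le hD
  refine ⟨fun i => D i, fun i => (D i).2, ⟨j, b, hb, fun i hi => congrArg Fin.val (hper i hi)⟩,
    fun e => ?_⟩
  have hDe := hD e
  rw [wordAction_eq_smul hF] at hDe
  refine mu_eq_succ_of_forall (fun h => hDe.1 ((hker _ _).2 h)) ((hker _ _).1 ?_)
  rw [pow_succ', mul_smul]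
  exact hDe.2

end FPureThreshold

/-! ### Generating functions of eventually periodic digits -/

theorem wordValue_lt_pow {p : ℕ} {D : ℕ → ℕ} (hD : ∀ i, D i < p) (e : ℕ) :
    wordValue p D e < p ^ e := by
  induction e with
  | zero => simp [wordValue]
  | succ e ih =>
    rw [wordValue, pow_succ']
    have := Nat.mul_le_mul_left p (Nat.succ_le_of_lt ih)
    have := hD e
    rw [Nat.mul_succ] at *
    omega

theorem pow_mul_wordValue_le (p : ℕ) (D : ℕ → ℕ) (e k : ℕ) :
    p ^ k * wordValue p D e ≤ wordValue p D (e + k) := by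
  induction k with
  | zero => simp
  | succ k ih =>
    rw [← add_assoc, wordValue, pow_succ', mul_assoc]
    exact (Nat.mul_le_mul_left p ih).trans (Nat.le_add_right _ _)

/-- Multiplication of a power series by a polynomial, evaluated at a point of convergence. -/
theorem PowerSeries.hasSum_polynomial_mul {A : PowerSeries ℚ} {z S : ℂ}
    (h : HasSum (fun n => ((PowerSeries.coeff n A : ℚ) : ℂ) * z ^ n) S) (q : Polynomial ℚ) :
    HasSum (fun n => ((PowerSeries.coeff n ((q : PowerSeries ℚ) * A) : ℚ) : ℂ) * z ^ n)
      (Polynomial.aeval z q * S) := by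
  induction q using Polynomial.induction_on' with
  | add q r hq hr =>
    simp only [Polynomial.coe_add, add_mul, map_add, Rat.cast_add]
    exact hq.add hr
  | monomial k a =>
    have h1 : ((Polynomial.monomial k a : Polynomial ℚ) : PowerSeries ℚ) * A =
        PowerSeries.C a * (PowerSeries.X ^ k * A) := by
      rw [Polynomial.coe_monomial, PowerSeries.monomial_eq_C_mul_X_pow, mul_assoc]
    rw [Polynomial.aeval_monomial, h1, ← Function.Injective.hasSum_iff (add_left_injective k)]
    · simp only [Function.comp_def, PowerSeries.coeff_C_mul, PowerSeries.coeff_X_pow_mul]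
      convert! h.mul_left ((a : ℂ) * z ^ k) using 2 with n
      push_cast
      ring
    · intro n hn
      have : ¬ k ≤ n := fun hk => hn ⟨n - k, by simp [hk]⟩
      simp [PowerSeries.coeff_X_pow_mul', this]

theorem Polynomial.hasSum_coeff_mul_pow (q : Polynomial ℚ) (z : ℂ) :
    HasSum (fun n => (q.coeff n : ℂ) * z ^ n) (Polynomial.aeval z q) := by
  have h : HasSum (fun n => ((PowerSeries.coeff n (1 : PowerSeries ℚ) : ℚ) : ℂ) * z ^ n) 1 := by
    convert! hasSum_ite_eq 0 (1 : ℂ) using 2 with n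
    rw [PowerSeries.coeff_one]
    split_ifs with h <;> simp [h]
  simpa using PowerSeries.hasSum_polynomial_mul h q

/-- Where the denominator does not vanish, a quotient of polynomials takes the expected value. -/
theorem FPureThreshold.toFun_eq_div {G : RatFunc ℚ} {P Q : Polynomial ℚ}
    (hG : G.num * Q = P * G.denom) {z : ℂ} (hz : Polynomial.aeval z Q ≠ 0) :
    FPureThreshold.toFun G z = Polynomial.aeval z P / Polynomial.aeval z Q := by
  have hdvd : G.denom ∣ Q :=
    (RatFunc.isCoprime_num_denom G).symm.dvd_of_dvd_mul_left ⟨P, by rw [hG, mul_comm]⟩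
  have hd : Polynomial.aeval z G.denom ≠ 0 := by
    obtain ⟨c, rfl⟩ := hdvd
    rw [map_mul] at hz
    exact left_ne_zero_of_mul hz
  have h1 := congrArg (Polynomial.aeval z) hG
  rw [map_mul, map_mul] at h1
  rw [FPureThreshold.toFun, RatFunc.eval, ← Polynomial.aeval_def, ← Polynomial.aeval_def,
    div_eq_div_iff hd hz, h1]

section Rational

open Polynomial in
/-- For a sequence with `m (e + 1) - p * m e` eventually periodic of period `b`, the product of
`(1 - z ^ b) * (1 - p z)` and the generating function is a polynomial. -/
theorem exists_polynomial_eq_mul_genFun {p b j : ℕ} {m : ℕ → ℕ}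
    (hper : ∀ e ≥ j, (m (e + b + 1) : ℚ) - p * m (e + b) = m (e + 1) - p * m e) :
    ∃ P : ℚ[X], ((1 - X ^ b : ℚ[X]) : PowerSeries ℚ) * (((1 - C (p : ℚ) * X : ℚ[X]) :
      PowerSeries ℚ) * PowerSeries.mk fun e => (m e : ℚ)) = (P : PowerSeries ℚ) := by
  set B := ((1 - C (p : ℚ) * X : ℚ[X]) : PowerSeries ℚ) * PowerSeries.mk fun e => (m e : ℚ) with hB
  have hBc : ∀ e, PowerSeries.coeff (e + 1) B = (m (e + 1) : ℚ) - p * m e := fun e => by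
    rw [hB, Polynomial.coe_sub, Polynomial.coe_one, sub_mul, one_mul, map_sub, PowerSeries.coeff_mk,
      Polynomial.coe_mul, Polynomial.coe_C, Polynomial.coe_X, mul_assoc, PowerSeries.coeff_C_mul,
      PowerSeries.coeff_succ_X_mul, PowerSeries.coeff_mk]
  refine ⟨PowerSeries.trunc (j + 1 + b) (((1 - X ^ b : ℚ[X]) : PowerSeries ℚ) * B), ?_⟩
  ext n
  rw [Polynomial.coeff_coe, PowerSeries.coeff_trunc]
  split_ifs with hn
  · rfl
  · obtain ⟨k, rfl⟩ : ∃ k, n = (j + k) + b + 1 := ⟨n - (j + 1 + b), by omega⟩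
    have h2 : j + k + b + 1 = (j + k + 1) + b := by ring
    rw [Polynomial.coe_sub, Polynomial.coe_one, sub_mul, one_mul, map_sub, hBc,
      Polynomial.coe_pow, Polynomial.coe_X, h2, PowerSeries.coeff_X_pow_mul, hBc, ← h2,
      hper _ (Nat.le_add_right j k), sub_self]

open Polynomial in
/-- The generating function of an integer sequence whose consecutive differences
`m (e + 1) - p * m e` are bounded and eventually periodic. The factor `1 - p z` turns the series
into one with bounded coefficients, whose value at `1 / p` telescopes to `lim m e / p ^ e`. -/
theorem exists_ratFunc_of_periodic {p b j : ℕ} (hp : 2 ≤ p) (hb : 0 < b) {m : ℕ → ℕ}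
    (hm0 : m 0 = 1) (hle : ∀ e, m e ≤ p ^ e)
    (hbdd : ∀ e, |(m (e + 1) : ℝ) - p * m e| ≤ p)
    (hper : ∀ e ≥ j, (m (e + b + 1) : ℚ) - p * m (e + b) = m (e + 1) - p * m e) {c : ℝ}
    (hc : Tendsto (fun e => (m e : ℝ) / (p : ℝ) ^ e) atTop (𝓝 c)) :
    ∃ G : RatFunc ℚ,
      (G.denom : PowerSeries ℚ) * PowerSeries.mk (fun e => (m e : ℚ)) = (G.num : PowerSeries ℚ) ∧
      (∀ z : ℂ, ‖z‖ < 1 / (p : ℝ) →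
        HasSum (fun e : ℕ => (m e : ℂ) * z ^ e) (FPureThreshold.toFun G z)) ∧
      (c ≠ 0 → meromorphicOrderAt (FPureThreshold.toFun G) (1 / (p : ℂ)) = -1) ∧
      Tendsto (fun z : ℂ => (1 - (p : ℂ) * z) * FPureThreshold.toFun G z)
        (𝓝[≠] (1 / (p : ℂ))) (𝓝 (c : ℂ)) := by
  obtain ⟨P, hP⟩ := exists_polynomial_eq_mul_genFun hper
  have hp0 : (p : ℂ) ≠ 0 := by exact_mod_cast (by omega : p ≠ 0)
  have hpR : (2 : ℝ) ≤ p := by exact_mod_cast hp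
  set A : PowerSeries ℚ := PowerSeries.mk fun e => (m e : ℚ) with hA
  set U : ℚ[X] := 1 - X ^ b with hU
  set V : ℚ[X] := 1 - C (p : ℚ) * X with hV
  have hUz : ∀ z : ℂ, aeval z U = 1 - z ^ b := fun z => by simp [hU]
  have hVz : ∀ z : ℂ, aeval z V = 1 - p * z := fun z => by simp [hV]
  have hU0 : ∀ z : ℂ, ‖z‖ < 1 → aeval z U ≠ 0 := fun z hz h => by
    rw [hUz, sub_eq_zero] at h
    have h1 := congrArg norm h
    rw [norm_one, norm_pow] at h1
    exact absurd h1.symm (pow_lt_one₀ (norm_nonneg z) hz hb.ne').ne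
  have hpinv : ‖(1 / (p : ℂ))‖ < 1 := by
    rw [norm_div, norm_one, Complex.norm_natCast, div_lt_one (by linarith)]
    linarith
  set Q := U * V with hQ
  have hQ0 : Q ≠ 0 := by
    intro h
    have h1 := congrArg (Polynomial.eval 0) h
    simp [hQ, hU, hV, hb.ne'] at h1
  let G : RatFunc ℚ := algebraMap ℚ[X] (RatFunc ℚ) P / algebraMap ℚ[X] (RatFunc ℚ) Q
  have hG : G.num * Q = P * G.denom := (RatFunc.num_mul_eq_mul_denom_iff hQ0).2 rfl
  -- values of `G` away from the zeros of the denominator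
  have hval : ∀ z : ℂ, z ≠ 1 / (p : ℂ) → aeval z U ≠ 0 →
      FPureThreshold.toFun G z = aeval z P / (aeval z U * (1 - p * z)) := fun z hz hzU => by
    have hzV : (1 : ℂ) - p * z ≠ 0 := fun h => hz (by field_simp; linear_combination -h)
    rw [FPureThreshold.toFun_eq_div hG, hQ, map_mul, hVz]
    rw [hQ, map_mul, hVz]
    exact mul_ne_zero hzU hzV
  have hUcont : ∀ᶠ z : ℂ in 𝓝[≠] (1 / (p : ℂ)), aeval z U ≠ 0 :=
    eventually_nhdsWithin_of_eventually_nhds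
      ((Polynomial.continuous_aeval U).continuousAt.eventually_ne (hU0 _ hpinv))
  -- the value at `1 / p` of the series multiplied by `1 - p z`
  have hcoeff : ∀ e, PowerSeries.coeff (e + 1) ((V : PowerSeries ℚ) * A) =
      (m (e + 1) : ℚ) - p * m e := fun e => by
    rw [hV, hA, Polynomial.coe_sub, Polynomial.coe_one, sub_mul, one_mul, map_sub,
      PowerSeries.coeff_mk, Polynomial.coe_mul, Polynomial.coe_C, Polynomial.coe_X, mul_assoc,
      PowerSeries.coeff_C_mul, PowerSeries.coeff_succ_X_mul, PowerSeries.coeff_mk]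
  have hcoeff0 : PowerSeries.coeff 0 ((V : PowerSeries ℚ) * A) = 1 := by
    simp [hV, hA, hm0]
  have hsum : HasSum (fun n => ((PowerSeries.coeff n ((V : PowerSeries ℚ) * A) : ℚ) : ℂ) *
      (1 / (p : ℂ)) ^ n) c := by
    have hsummable : Summable (fun n => ((PowerSeries.coeff n ((V : PowerSeries ℚ) * A) : ℚ) : ℂ) *
        (1 / (p : ℂ)) ^ n) := by
      refine Summable.of_norm_bounded (g := fun n => (p : ℝ) * ‖1 / (p : ℂ)‖ ^ n)
        ((summable_geometric_of_lt_one (norm_nonneg _) hpinv).mul_left _) fun n => ?_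
      rw [norm_mul, norm_pow]
      gcongr
      cases n with
      | zero => rw [hcoeff0]; simp; linarith
      | succ n =>
        rw [hcoeff]
        have h1 : (((m (n + 1) : ℚ) - p * m n : ℚ) : ℂ) =
            (((m (n + 1) : ℝ) - p * m n : ℝ) : ℂ) := by
          push_cast
          ring
        rw [h1, Complex.norm_real, Real.norm_eq_abs]
        exact hbdd n
    have hpart : ∀ n, ∑ i ∈ Finset.range (n + 1),
        ((PowerSeries.coeff i ((V : PowerSeries ℚ) * A) : ℚ) : ℂ) * (1 / (p : ℂ)) ^ i =
        ((m n : ℝ) / (p : ℝ) ^ n : ℝ) := fun n => by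
      induction n with
      | zero => simp [hcoeff0, hm0]
      | succ n ih =>
        rw [Finset.sum_range_succ, ih, hcoeff, div_pow, one_pow]
        push_cast
        field_simp
        ring
    have h1 := (hsummable.hasSum.tendsto_sum_nat).comp (tendsto_add_atTop_nat 1)
    have h2 : Tendsto (fun n => (((m n : ℝ) / (p : ℝ) ^ n : ℝ) : ℂ)) atTop (𝓝 (c : ℂ)) :=
      (Complex.continuous_ofReal.tendsto c).comp hc
    rw [← tendsto_nhds_unique (h1.congr hpart) h2]
    exact hsummable.hasSum
  have hkey : aeval (1 / (p : ℂ)) U * c = aeval (1 / (p : ℂ)) P := by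
    have h1 := PowerSeries.hasSum_polynomial_mul hsum U
    rw [hP] at h1
    simp only [Polynomial.coeff_coe] at h1
    exact h1.unique (Polynomial.hasSum_coeff_mul_pow P _)
  have hlim : Tendsto (fun z : ℂ => aeval z P / aeval z U) (𝓝[≠] (1 / (p : ℂ))) (𝓝 (c : ℂ)) := by
    have h1 : ContinuousAt (fun z : ℂ => aeval z P / aeval z U) (1 / (p : ℂ)) :=
      (Polynomial.continuous_aeval P).continuousAt.div (Polynomial.continuous_aeval U).continuousAt
        (hU0 _ hpinv)
    have h2 : aeval (1 / (p : ℂ)) P / aeval (1 / (p : ℂ)) U = c := by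
      rw [← hkey, mul_div_cancel_left₀ _ (hU0 _ hpinv)]
    rw [← h2]
    exact h1.tendsto.mono_left nhdsWithin_le_nhds
  refine ⟨G, ?_, fun z hz => ?_, fun hc0 => ?_, ?_⟩
  · have hQP : (Q : PowerSeries ℚ) ≠ 0 := by simpa using hQ0
    refine mul_left_cancel₀ hQP ?_
    have h1 : (Q : PowerSeries ℚ) * A = P := by rw [hQ, Polynomial.coe_mul, mul_assoc, hP]
    rw [mul_left_comm, h1, ← Polynomial.coe_mul, ← Polynomial.coe_mul, mul_comm, ← hG, mul_comm]
  · have hz1 : (p : ℝ) * ‖z‖ < 1 := by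
      rw [lt_div_iff₀ (by linarith)] at hz
      linarith
    have hzlt : ‖z‖ < 1 := by nlinarith [norm_nonneg z]
    have hzp : z ≠ 1 / (p : ℂ) := by
      rintro rfl
      rw [norm_div, norm_one, Complex.norm_natCast] at hz
      exact lt_irrefl _ hz
    have hsummable : Summable (fun n => ((PowerSeries.coeff n A : ℚ) : ℂ) * z ^ n) := by
      refine Summable.of_norm_bounded (g := fun n => ((p : ℝ) * ‖z‖) ^ n)
        (summable_geometric_of_lt_one (by positivity) hz1) fun n => ?_
      rw [norm_mul, norm_pow, mul_pow, hA, PowerSeries.coeff_mk]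
      gcongr
      rw [Rat.cast_natCast, Complex.norm_natCast]
      exact_mod_cast hle n
    have h1 := PowerSeries.hasSum_polynomial_mul hsummable.hasSum Q
    rw [hQ, Polynomial.coe_mul, mul_assoc, hP] at h1
    simp only [Polynomial.coeff_coe] at h1
    have h2 := h1.unique (Polynomial.hasSum_coeff_mul_pow P z)
    have hzV : (1 : ℂ) - p * z ≠ 0 := fun h => hzp (by field_simp; linear_combination -h)
    have h3 := hsummable.hasSum
    rw [hval z hzp (hU0 z hzlt), ← h2, map_mul, hVz,
      mul_div_cancel_left₀ _ (mul_ne_zero (hU0 z hzlt) hzV)]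
    simpa [hA] using h3
  · have hmer : MeromorphicAt (FPureThreshold.toFun G) (1 / (p : ℂ)) := by
      have han : ∀ q : ℚ[X], MeromorphicAt (fun z : ℂ => aeval z q) (1 / (p : ℂ)) := fun q =>
        ((Polynomial.differentiable_aeval q).analyticAt _).meromorphicAt
      exact (han G.num).div (han G.denom)
    refine (meromorphicOrderAt_eq_int_iff (n := -1) hmer).2
      ⟨fun z => -(1 / (p : ℂ)) * (aeval z P / aeval z U), ?_, ?_, ?_⟩
    · exact analyticAt_const.mul (((Polynomial.differentiable_aeval P).analyticAt _).div
        ((Polynomial.differentiable_aeval U).analyticAt _) (hU0 _ hpinv))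
    · change -(1 / (p : ℂ)) * (aeval (1 / (p : ℂ)) P / aeval (1 / (p : ℂ)) U) ≠ 0
      rw [← hkey, mul_div_cancel_left₀ _ (hU0 _ hpinv)]
      exact mul_ne_zero (neg_ne_zero.2 (one_div_ne_zero hp0)) (by exact_mod_cast hc0)
    · filter_upwards [hUcont, self_mem_nhdsWithin] with z hzU hz
      have hz' : z - 1 / (p : ℂ) ≠ 0 := sub_ne_zero.2 hz
      have h1 : (1 : ℂ) - p * z = -p * (z - 1 / p) := by field_simp; ring
      rw [hval z hz hzU, h1, zpow_neg_one, smul_eq_mul]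
      generalize z - 1 / (p : ℂ) = w at *
      field_simp
  · refine hlim.congr' ?_
    filter_upwards [hUcont, self_mem_nhdsWithin] with z hzU hz
    have hzV : (1 : ℂ) - p * z ≠ 0 := fun h => hz (by
      rw [Set.mem_singleton_iff]; field_simp; linear_combination -h)
    rw [hval z hz hzU]
    field_simp

end Rational

/-- A nonzero `f` has positive `F`-pure threshold: by Krull's intersection theorem `f` lies outside
some bracket power `𝔪^[p^e]`, so that some digit of the threshold is nonzero. -/
theorem FPureThreshold.fpt_ne_zero {R : Type*} [CommRing R] [IsLocalRing R] [IsNoetherianRing R]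
    {p : ℕ} [hp : Fact p.Prime] [CharP R p] {f : R} (hf : f ∈ maximalIdeal R) (hf0 : f ≠ 0)
    {D : ℕ → ℕ} (hmu : ∀ e, mu f (p ^ e) = wordValue p D e + 1) : fpt p f ≠ 0 := by
  have hp0 : (0 : ℝ) < p := by exact_mod_cast hp.out.pos
  obtain ⟨e, he⟩ : ∃ e, wordValue p D e ≠ 0 := by
    by_contra! h
    refine hf0 ?_
    have hmem : f ∈ ⨅ n, maximalIdeal R ^ n := by
      rw [Ideal.mem_iInf]
      intro n
      have h1 := pow_mu_mem hf (p ^ n)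
      rw [hmu, h, zero_add, pow_one] at h1
      have h2 : bracketPower (maximalIdeal R) (p ^ n) ≤ maximalIdeal R ^ p ^ n := by
        rw [bracketPower, Ideal.span_le]
        rintro _ ⟨r, hr, rfl⟩
        exact Ideal.pow_mem_pow hr _
      exact Ideal.pow_le_pow_right (Nat.lt_pow_self hp.out.one_lt).le (h2 h1)
    rwa [Ideal.iInf_pow_eq_bot_of_isLocalRing _ (IsLocalRing.maximalIdeal.isMaximal R).ne_top]
      at hmem
  have h1 := (tendsto_fpt p hf).comp (tendsto_add_atTop_nat e)
  have h2 : (1 : ℝ) / (p : ℝ) ^ e ≤ fpt p f := by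
    refine ge_of_tendsto' h1 fun k => ?_
    have h3 : p ^ k ≤ mu f (p ^ (k + e)) := by
      rw [hmu, add_comm k e]
      have := pow_mul_wordValue_le p D e k
      have := Nat.le_mul_of_pos_right (p ^ k) (Nat.pos_of_ne_zero he)
      omega
    have h4 : (p : ℝ) ^ k ≤ mu f (p ^ (k + e)) := by exact_mod_cast h3
    rw [Function.comp_apply, div_le_div_iff₀ (by positivity) (by positivity), one_mul, pow_add]
    exact mul_le_mul_of_nonneg_right h4 (by positivity)
  exact ((by positivity : (0 : ℝ) < 1 / (p : ℝ) ^ e).trans_le h2).ne'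

theorem theorem2p3 {R : Type*} [CommRing R] [IsRegularLocalRing R] (p : ℕ) [Fact p.Prime]
    [CharP R p] (f : R) (hf : f ∈ maximalIdeal R) :
    ∃ G : RatFunc ℚ,
      -- `G` is the generating function, formally and as a convergent series
      (G.denom : PowerSeries ℚ) * FPureThreshold.genFun p f = (G.num : PowerSeries ℚ) ∧
      (∀ z : ℂ, ‖z‖ < 1 / (p : ℝ) →
        HasSum (fun e : ℕ => (FPureThreshold.mu f (p ^ e) : ℂ) * z ^ e)
          (FPureThreshold.toFun G z)) ∧
      -- simple pole at `1 / p`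
      (f ≠ 0 → meromorphicOrderAt (FPureThreshold.toFun G) (1 / (p : ℂ)) = -1) ∧
      Tendsto (fun z : ℂ => (1 - (p : ℂ) * z) * FPureThreshold.toFun G z)
        (𝓝[≠] (1 / (p : ℂ))) (𝓝 (FPureThreshold.fpt p f : ℂ)) := by
  have hp := (Fact.out : p.Prime)
  obtain ⟨D, hD, ⟨j, b, hb, hper⟩, hmu⟩ := FPureThreshold.exists_periodic_digits p f hf
  -- the recursion `μ (p ^ (e + 1)) = p μ (p ^ e) - (p - 1) + D e`
  have hrec : ∀ e, (FPureThreshold.mu f (p ^ (e + 1)) : ℚ) - p * FPureThreshold.mu f (p ^ e) =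
      D e + 1 - p := fun e => by
    rw [hmu, hmu, wordValue]
    push_cast
    ring
  obtain ⟨G, h1, h2, h3, h4⟩ := exists_ratFunc_of_periodic (p := p) (b := b) (j := j)
    (m := fun e => FPureThreshold.mu f (p ^ e)) hp.two_le hb (hmu 0)
    (fun e => by rw [hmu]; exact Nat.succ_le_of_lt (wordValue_lt_pow hD e))
    (fun e => by
      have h5 : (FPureThreshold.mu f (p ^ (e + 1)) : ℝ) - p * FPureThreshold.mu f (p ^ e) =
          D e + 1 - p := by exact_mod_cast hrec e
      rw [h5, abs_le]
      have h6 : (D e : ℝ) + 1 ≤ p := by exact_mod_cast hD e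
      have h7 : (0 : ℝ) ≤ D e := Nat.cast_nonneg _
      constructor <;> linarith)
    (fun e he => by rw [hrec, hrec, hper e he]) (FPureThreshold.tendsto_fpt p hf)
  exact ⟨G, h1, h2, fun hf0 => h3 (FPureThreshold.fpt_ne_zero hf hf0 hmu), h4⟩
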